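/- Let $a_1,a_2,a_3\in\mathbb R^2$ be the vertices of an equilateral triangle of side $1$, $\Gamma=\{a_1,a_2,a_3\}$, $\psi_i(x)=a_i+\tfrac12(x-a_i)$, and for $n\ge 0$ let $V^n$ be the union of the sets $\psi_{i_1}\circ\dots\circ\psi_{i_n}(\Gamma)$; write $x\sim_n y$ if $x=\psi_{i_1}\circ\dots\circ\psi_{i_n}(a_i)$ and $y=\psi_{i_1}\circ\dots\circ\psi_{i_n}(a_j)$ for some word $i_1,\dots,i_n$ and some $i\ne j$. Let $S=\overline{\bigcup_{n}V^n}$ be the Sierpinski gasket, $h_n=2^{-n}$, and let $d(x,y)$ be the geodesic distance on $S$, i.e. the infimum of the lengths of the paths in $S$ joining $x$ to $y$. For an interval $I$ and $\Omega\subset S$ let $\mathcal A(I,\Omega)$ be the set of curves $\xi:I\to\Omega$ that are absolutely continuous with respect to $d$ (the metric derivative $|\xi'|(t)=\lim_{s\to t}d(\xi(s),\xi(t))/|s-t|$ exists for a.e. $t\in I$, is in $L^1_{loc}(I)$, and $d(\xi(s),\xi(t))\le\int_s^t|\xi'|(r)\,dr$ for $s\le t$) and satisfy $|\xi'|\le 1$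 a.e. A function $u$ is arcwise upper (lower) semicontinuous in $\Omega$ if $u\circ\xi$ is upper (lower) semicontinuous for every $\xi\in\mathcal A(I,\Omega)$ and every interval $I$. $D^{\pm}w(t)$ denote the super- and subdifferential of $w$ at $t$. Let $f:S\to\mathbb R$ be continuous with $\inf_S f>0$, let $g:\Gamma\to\mathbb R$, and put $\Omega=S\setminus\Gamma$. * A solution of the graph eikonal equation of level $n$ is a function $v:V^n\to\mathbb R$ with $\max_{y\sim_n x}\{-\frac1{h_n}(v(y)-v(x))\}=f(x)$ for all $x\in V^n\setminus\Gamma$ and $v=g$ on $\Gamma$. * A metric viscosity solution of $|Du|=f$ in $S\setminus\Gamma$, $u=g$ on $\Gamma$, is a function $u:S\to\mathbb R$, arcwise upper and lower semicontinuous in $S$, with $u=g$ on $\Gamma$, such that (sub) for every open interval $I\ni 0$ and every $\xi\in\mathcal A(I,\Omega)$, every $p\in D^+(u\circ\xi)(0)$ satisfies $|p|\le f(\xi(0))$; (super) for every $x\in\Omega$ and $\varepsilon>0$ there are $\xi\in\mathcal A(\mathbb R,S)$ with $\xi(0)=x$ and a lower semicontinuous $w:\mathbb R\to\mathbb R$ such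 that $T^+=\inf\{t\ge0:\xi(t)\in\Gamma\}$ and $T^-=\sup\{t\le0:\xi(t)\in\Gamma\}$ are finite, $w(0)=u(x)$, and for all $t\in(T^-,T^+)$ one has $w(t)\ge u(\xi(t))-\varepsilon$ and $|p|\ge f(\xi(t))-\varepsilon$ for all $p\in D^-w(t)$. Assume that (compatS) $g(x)\le\int_0^Tf(\xi(t))\,dt+g(y)$ for all $x,y\in\Gamma$, all $T\ge 0$ and all $\xi\in\mathcal A([0,T],S)$ with $\xi(0)=x$, $\xi(T)=y$; (compatD) for every $n\ge1$, $g(x)\le\sum_{k=0}^Nh_nf(x_k)+g(y)$ for all $x,y\in\Gamma$ and all finite paths $x=x_0\sim_n x_1\sim_n\dots\sim_n x_N=y$. Then for every $n$ the graph eikonal equation of level $n$ has a unique solution $u_{h_n}$, the eikonal equation on $S$ has a unique metric viscosity solution $u$, and $u_{h_n}$ converges uniformly to $u$: $$\lim_{n\to\infty}\ \max_{x\in V^n}|u_{h_n}(x)-u(x)|=0 .$$ -/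

import Mathlib

open Set Filter Topology MeasureTheory

noncomputable section

namespace SierpinskiEikonal

/-! ### The Sierpinski gasket and its prefractal graphs -/

/-- The Euclidean plane. -/
abbrev Plane : Type := EuclideanSpace ℝ (Fin 2)

/-- The contraction of ratio `1/2` centred at the `i`-th vertex. -/
def contraction (a : Fin 3 → Plane) (i : Fin 3) (x : Plane) : Plane :=
  a i + (1 / 2 : ℝ) • (x - a i)

/-- The composition of the contractions along a word. -/
def cellMap (a : Fin 3 → Plane) : List (Fin 3) → Plane → Plane
  | [] => id
  | i :: w => contraction a i ∘ cellMap a w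

/-- The level `n` vertex set: all images of the three vertices under words of length `n`. -/
def vertexSet (a : Fin 3 → Plane) (n : ℕ) : Set Plane :=
  {x | ∃ (w : List (Fin 3)) (i : Fin 3), w.length = n ∧ x = cellMap a w (a i)}

/-- Adjacency at level `n`: `x` and `y` are the endpoints of the image of a side of the initial
triangle under a word of length `n`. -/
def Adj (a : Fin 3 → Plane) (n : ℕ) (x y : Plane) : Prop :=
  ∃ (w : List (Fin 3)) (i j : Fin 3), w.length = n ∧ i ≠ j ∧
    x = cellMap a w (a i) ∧ y = cellMap a w (a j)

/-- The Sierpinski gasket: the Euclidean closure of the union of all vertex sets. -/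
def gasket (a : Fin 3 → Plane) : Set Plane := closure (⋃ n, vertexSet a n)

/-- The gasket as a space, with the subspace topology. -/
abbrev Gasket (a : Fin 3 → Plane) : Type := ↥(gasket a)

/-- The boundary of the gasket: the three vertices of the initial triangle. -/
def bdry (a : Fin 3 → Plane) : Set (Gasket a) := {x | ∃ i, (x : Plane) = a i}

/-- The level `n` vertices, as points of the gasket. -/
def vertices (a : Fin 3 → Plane) (n : ℕ) : Set (Gasket a) := {x | (x : Plane) ∈ vertexSet a n}

/-- The mesh size at level `n`. -/
def mesh (n : ℕ) : ℝ := 1 / 2 ^ n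

/-! ### The graph eikonal equation -/

/-- The discrete gradient: the maximum, over the neighbours `y` of `x` at level `n`, of
`-(u y - u x) / h`, where `h` is the mesh size. (The family is finite, and it is non-empty at every
vertex.) -/
def discreteGrad (a : Fin 3 → Plane) (n : ℕ) (u : vertices a n → ℝ) (x : vertices a n) : ℝ :=
  ⨆ y : {y : vertices a n // Adj a n (y.1 : Plane) (x.1 : Plane)},
    -(1 / mesh n) * (u y.1 - u x)

/-- `u` solves the graph eikonal equation at all interior vertices of level `n`, with
boundary data `g`. -/
def IsDiscreteSolution (a : Fin 3 → Plane) (n : ℕ) (f : Gasket a → ℝ) (g : bdry a → ℝ)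
    (u : vertices a n → ℝ) : Prop :=
  (∀ x : vertices a n, x.1 ∉ bdry a → discreteGrad a n u x = f x.1) ∧
  (∀ (x : vertices a n) (hx : x.1 ∈ bdry a), u x = g ⟨x.1, hx⟩)

/-- The discrete compatibility condition at level `n`: for all boundary points `x`, `y` and every
finite path `x = p 0 ∼ p 1 ∼ ... ∼ p N = y` at level `n`, one has
`g x ≤ ∑_{k=0}^N h * f (p k) + g y`. -/
def CompatDiscrete (a : Fin 3 → Plane) (n : ℕ) (f : Gasket a → ℝ) (g : bdry a → ℝ) : Prop :=
  ∀ (x y : bdry a) (N : ℕ) (p : ℕ → Gasket a),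
    p 0 = x.1 → p N = y.1 → (∀ k < N, Adj a n (p k : Plane) (p (k + 1) : Plane)) →
    g x ≤ (∑ k ∈ Finset.range (N + 1), mesh n * f (p k)) + g y

/-! ### The geodesic distance and admissible curves -/

/-- The geodesic distance: the infimum of the (Euclidean) lengths of the continuous paths in the
gasket that join `x` to `y`. (It is finite, the gasket being connected by rectifiable paths.) -/
def geodist (a : Fin 3 → Plane) (x y : Gasket a) : ℝ :=
  (⨅ γ : Path x y, eVariationOn γ Set.univ).toReal

/-- The curve `ξ`, considered on `I`, has metric derivative `m` at `t` for the geodesic distance. -/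
def HasMetricDeriv (a : Fin 3 → Plane) (I : Set ℝ) (ξ : ℝ → Gasket a) (m t : ℝ) : Prop :=
  Tendsto (fun s => geodist a (ξ s) (ξ t) / |s - t|) (𝓝[I \ {t}] t) (𝓝 m)

/-- Admissible curves on the interval `I` with values in `Ω`: absolutely continuous curves (for the
geodesic distance) whose metric derivative is at most `1` almost everywhere in `I`. Values of `ξ`
outside `I` play no role. -/
def IsAdmissible (a : Fin 3 → Plane) (I : Set ℝ) (Ω : Set (Gasket a)) (ξ : ℝ → Gasket a) : Prop :=
  (∀ t ∈ I, ξ t ∈ Ω) ∧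
  ∃ m : ℝ → ℝ, LocallyIntegrableOn m I ∧
    (∀ᵐ t, t ∈ I → HasMetricDeriv a I ξ (m t) t) ∧
    (∀ s ∈ I, ∀ t ∈ I, s ≤ t → geodist a (ξ s) (ξ t) ≤ ∫ r in s..t, m r) ∧
    (∀ᵐ t, t ∈ I → m t ≤ 1)

/-- The compatibility condition on the gasket: for all boundary points `x`, `y` and every admissible
curve in the gasket from `x` to `y`, one has `g x ≤ ∫ f(ξ(t)) dt + g y`. -/
def CompatGasket (a : Fin 3 → Plane) (f : Gasket a → ℝ) (g : bdry a → ℝ) : Prop :=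
  ∀ (x y : bdry a) (T : ℝ) (ξ : ℝ → Gasket a), 0 ≤ T → IsAdmissible a (Icc 0 T) Set.univ ξ →
    ξ 0 = x.1 → ξ T = y.1 → g x ≤ (∫ t in (0 : ℝ)..T, f (ξ t)) + g y

/-! ### Metric viscosity solutions -/

/-- Arcwise upper semicontinuity in `Ω`. -/
def ArcwiseUSC (a : Fin 3 → Plane) (Ω : Set (Gasket a)) (u : Gasket a → ℝ) : Prop :=
  ∀ (I : Set ℝ) (ξ : ℝ → Gasket a), I.OrdConnected → IsAdmissible a I Ω ξ →
    UpperSemicontinuousOn (fun t => u (ξ t)) I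

/-- Arcwise lower semicontinuity in `Ω`. -/
def ArcwiseLSC (a : Fin 3 → Plane) (Ω : Set (Gasket a)) (u : Gasket a → ℝ) : Prop :=
  ∀ (I : Set ℝ) (ξ : ℝ → Gasket a), I.OrdConnected → IsAdmissible a I Ω ξ →
    LowerSemicontinuousOn (fun t => u (ξ t)) I

/-- The superdifferential of `w` at `t`. -/
def superdiff (w : ℝ → ℝ) (t : ℝ) : Set ℝ :=
  {p | ∀ ε > 0, ∀ᶠ s in 𝓝 t, w s ≤ w t + p * (s - t) + ε * |s - t|}

/-- The subdifferential of `w` at `t`. -/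
def subdiff (w : ℝ → ℝ) (t : ℝ) : Set ℝ :=
  {p | ∀ ε > 0, ∀ᶠ s in 𝓝 t, w t + p * (s - t) - ε * |s - t| ≤ w s}

/-- Metric viscosity subsolutions of `|Du| = f` in the gasket minus its boundary. The curves are
defined on open intervals around `0`. -/
def IsMetricSubsolution (a : Fin 3 → Plane) (f u : Gasket a → ℝ) : Prop :=
  ArcwiseUSC a (bdry a)ᶜ u ∧
  ∀ (I : Set ℝ) (ξ : ℝ → Gasket a), IsOpen I → I.OrdConnected → (0 : ℝ) ∈ I →
    IsAdmissible a I (bdry a)ᶜ ξ → ∀ p ∈ superdiff (fun t => u (ξ t)) 0, |p| ≤ f (ξ 0)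

/-- Metric viscosity supersolutions of `|Du| = f` in the gasket minus its boundary. `Tp` and `Tm`
are the exit and entrance times of the curve, that is, `inf {t ≥ 0 | ξ t ∈ bdry}` and
`sup {t ≤ 0 | ξ t ∈ bdry}`; that they are real numbers is the requirement that both are finite. -/
def IsMetricSupersolution (a : Fin 3 → Plane) (f v : Gasket a → ℝ) : Prop :=
  ArcwiseLSC a (bdry a)ᶜ v ∧
  ∀ x ∉ bdry a, ∀ ε > 0, ∃ (ξ : ℝ → Gasket a) (w : ℝ → ℝ) (Tm Tp : ℝ),
    IsAdmissible a Set.univ Set.univ ξ ∧ ξ 0 = x ∧ LowerSemicontinuous w ∧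
    IsLUB {t | t ≤ 0 ∧ ξ t ∈ bdry a} Tm ∧ IsGLB {t | 0 ≤ t ∧ ξ t ∈ bdry a} Tp ∧
    w 0 = v x ∧ (∀ t ∈ Ioo Tm Tp, v (ξ t) - ε ≤ w t) ∧
    ∀ t ∈ Ioo Tm Tp, ∀ p ∈ subdiff w t, f (ξ t) - ε ≤ |p|

/-- Metric viscosity solutions of the Dirichlet problem `|Du| = f` in the gasket minus its boundary,
`u = g` on the boundary. The semicontinuity holds up to the boundary. -/
def IsMetricSolution (a : Fin 3 → Plane) (f : Gasket a → ℝ) (g : bdry a → ℝ)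
    (u : Gasket a → ℝ) : Prop :=
  IsMetricSubsolution a f u ∧ IsMetricSupersolution a f u ∧
  ArcwiseUSC a Set.univ u ∧ ArcwiseLSC a Set.univ u ∧
  ∀ x : bdry a, u x.1 = g x

end SierpinskiEikonal

end

open SierpinskiEikonal

/-!
Write `h` for `mesh n` and `m` for the minimum of `g`.

*Admissible curves.* On an interval, a curve in the gasket is admissible if and only if it is
`1`-Lipschitz for the Euclidean distance. Indeed the geodesic distance dominates the Euclidean one,
and for a `1`-Lipschitz curve it is bounded by the integral of the norm of the derivative, so that
the theorems of Rademacher and Lebesgue give the metric derivative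
(`isAdmissible_of_lipschitzWith`, `IsAdmissible.dist_le`). The geodesic distance has to be finite
for this: every point of the gasket is joined to a corner by a `1`-Lipschitz curve
(`exists_curve_to_corner`).

*The metric solution.* It is the value function `value`, the infimum of `∫ f(ξ) + g(ξ(T))` over the
`1`-Lipschitz curves that end on the boundary. By dynamic programming it changes along a curve at a
rate of at most `f`, which makes it a subsolution, continuous along curves; a near-optimal curve,
run in both directions, shows that it is a supersolution; compatibility on the gasket gives the
boundary values. Conversely let `u` be any solution. Along a curve, `u` is a one-dimensional
viscosity subsolution of `|W'| ≤ f`, so it decreases by at most the integral of `f`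
(`le_integral_add_of_superdiff`), and `u ≤ value`. The function `w` of the supersolution property
satisfies `|w'| ≥ f - ε`, so one of the two halves of the curve has a cost of at most `u(x)` up to
`O(ε)` (`min_le_of_subdiff`), and `value ≤ u`.

*The discrete solutions.* A function on the vertices solves the graph equation if and only if
`v x = h f(x) + min v(y)` over the neighbours `y` of each interior vertex `x`. Existence is Perron's
method, and uniqueness follows from induction along the steepest descent. Suppose that
`f x ≤ K f y` whenever `dist x y ≤ h`. A curve that starts at a vertex `x` visits an adjacent vertex
before any other one (`adj_of_passage`) and needs a time of at least `h` for it, whence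
`v ≤ K value - (K - 1) m`. An edge is the trace of a curve of duration `h`, whence
`value ≤ K v - (K - 1) m`. As `n → ∞` the uniform continuity of `f` allows `K → 1`, which is the
uniform convergence.
-/

namespace SierpinskiEikonal

/-! ### Curves of speed at most one -/

lemma lipschitzWith_one_iff {X : Type*} [PseudoMetricSpace X] {ξ : ℝ → X} :
    LipschitzWith 1 ξ ↔ ∀ s t, dist (ξ s) (ξ t) ≤ |s - t| := by
  rw [lipschitzWith_iff_dist_le_mul]
  simp [Real.dist_eq]

lemma lipschitzWith_one_of_le {X : Type*} [PseudoMetricSpace X] {ξ : ℝ → X}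
    (h : ∀ s t, s ≤ t → dist (ξ s) (ξ t) ≤ t - s) : LipschitzWith 1 ξ := by
  rw [lipschitzWith_one_iff]
  intro s t
  rcases le_total s t with hst | hst
  · rw [abs_sub_comm, abs_of_nonneg (sub_nonneg.2 hst)]; exact h s t hst
  · rw [dist_comm, abs_of_nonneg (sub_nonneg.2 hst)]; exact h t s hst

lemma dist_le_sub_of_lipschitzWith {X : Type*} [PseudoMetricSpace X] {ξ : ℝ → X}
    (h : LipschitzWith 1 ξ) {s t : ℝ} (hst : s ≤ t) : dist (ξ s) (ξ t) ≤ t - s := by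
  have := lipschitzWith_one_iff.1 h s t
  rwa [abs_sub_comm, abs_of_nonneg (sub_nonneg.2 hst)] at this

lemma lipschitzWith_glue {X : Type*} [PseudoMetricSpace X] {ξ η : ℝ → X} {b : ℝ}
    (hξ : LipschitzWith 1 ξ) (hη : LipschitzWith 1 η) (hb : ξ b = η b) :
    LipschitzWith 1 (fun r => if r ≤ b then ξ r else η r) := by
  apply lipschitzWith_one_of_le
  intro s t hst
  by_cases hs : s ≤ b <;> by_cases ht : t ≤ b
  · simpa [hs, ht] using dist_le_sub_of_lipschitzWith hξ hst
  · simp only [hs, ht, if_true, if_false]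
    have h1 := dist_le_sub_of_lipschitzWith hξ hs
    have h2 := dist_le_sub_of_lipschitzWith hη (not_le.1 ht).le
    have h3 := dist_triangle (ξ s) (ξ b) (η t)
    rw [← hb] at h2
    linarith
  · exact absurd (hst.trans ht) hs
  · simpa [hs, ht] using dist_le_sub_of_lipschitzWith hη hst

lemma lipschitzWith_one_comp {X : Type*} [PseudoMetricSpace X] {ξ : ℝ → X}
    (hξ : LipschitzWith 1 ξ) {φ : ℝ → ℝ} (hφ : LipschitzWith 1 φ) :
    LipschitzWith 1 (fun t => ξ (φ t)) := by
  simpa [Function.comp_def] using hξ.comp hφ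

lemma lipschitzWith_one_add_right {X : Type*} [PseudoMetricSpace X] {ξ : ℝ → X}
    (hξ : LipschitzWith 1 ξ) (c : ℝ) : LipschitzWith 1 (fun t => ξ (t + c)) :=
  lipschitzWith_one_comp hξ (lipschitzWith_one_iff.2 fun s t => by simp [Real.dist_eq])

/-! ### Barycentric coordinates -/

/-- The barycentre of the initial triangle. -/
noncomputable def centroid (a : Fin 3 → Plane) : Plane := (1 / 3 : ℝ) • ∑ i, a i

/-- The barycentric coordinate with respect to the `i`-th vertex of an equilateral triangle of
side `1`, written as an affine function with the help of the inner product. -/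
noncomputable def bary (a : Fin 3 → Plane) (i : Fin 3) (x : Plane) : ℝ :=
  1 / 3 + 2 * inner ℝ (x - centroid a) (a i - centroid a)

variable {a : Fin 3 → Plane}

lemma inner_sub_centroid (i j : Fin 3) :
    inner ℝ (a i - centroid a) (a j - centroid a) =
      -(1 / 2) * dist (a i) (a j) ^ 2 + (1 / 6) * ∑ k, dist (a i) (a k) ^ 2
        + (1 / 6) * ∑ k, dist (a j) (a k) ^ 2 - (1 / 18) * ∑ k, ∑ l, dist (a k) (a l) ^ 2 := by
  have hd : ∀ x y : Plane, dist x y ^ 2 = (x 0 - y 0) ^ 2 + (x 1 - y 1) ^ 2 := by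
    intro x y
    rw [EuclideanSpace.dist_eq, Real.sq_sqrt (by positivity), Fin.sum_univ_two]
    simp [Real.dist_eq, sq_abs]
  simp only [hd, centroid, PiLp.inner_apply, Fin.sum_univ_two, Fin.sum_univ_three]
  simp
  ring

lemma bary_vertex (ha : ∀ i j, i ≠ j → dist (a i) (a j) = 1) (i j : Fin 3) :
    bary a i (a j) = if j = i then 1 else 0 := by
  have hd : ∀ k l, dist (a k) (a l) ^ 2 = if k = l then 0 else 1 := by
    intro k l
    split_ifs with h
    · simp [h]
    · simp [ha k l h]
  rw [bary, inner_sub_centroid]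
  simp only [hd, Fin.sum_univ_three]
  fin_cases i <;> fin_cases j <;> norm_num [Fin.ext_iff]

lemma sum_bary (x : Plane) : ∑ i, bary a i x = 1 := by
  have h : ∑ i, (a i - centroid a) = 0 := by
    rw [Finset.sum_sub_distrib, centroid]
    simp only [Finset.sum_const, Finset.card_univ, Fintype.card_fin]
    module
  simp only [bary]
  rw [Finset.sum_add_distrib, ← Finset.mul_sum, ← inner_sum, h]
  simp

lemma continuous_bary (i : Fin 3) : Continuous (bary a i) := by
  unfold bary
  fun_prop

lemma bary_contraction (ha : ∀ i j, i ≠ j → dist (a i) (a j) = 1) (i j : Fin 3) (x : Plane) :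
    bary a j (contraction a i x) = ((if i = j then 1 else 0) + bary a j x) / 2 := by
  rw [← bary_vertex ha j i]
  have : contraction a i x - centroid a =
      (1 / 2 : ℝ) • (a i - centroid a) + (1 / 2 : ℝ) • (x - centroid a) := by
    rw [contraction]; module
  simp only [bary, this, inner_add_left, inner_smul_left]
  simp
  ring

/-- The offset of a cell: at level `n = w.length`, the cell of the word `w` is the part of the
gasket where `offset w j ≤ 2 ^ n * bary a j x ≤ offset w j + 1` for all `j`. -/
def offset : List (Fin 3) → Fin 3 → ℤ
  | [], _ => 0
  | i :: w, j => (if i = j then 2 ^ w.length else 0) + offset w j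

lemma bary_cellMap (ha : ∀ i j, i ≠ j → dist (a i) (a j) = 1) (w : List (Fin 3)) (j : Fin 3)
    (x : Plane) : 2 ^ w.length * bary a j (cellMap a w x) = offset w j + bary a j x := by
  induction w with
  | nil => simp [cellMap, offset]
  | cons i w ih =>
    simp only [cellMap, Function.comp, bary_contraction ha, List.length_cons, offset, pow_succ]
    push_cast
    have : (2 : ℝ) ^ w.length * 2 * (((if i = j then 1 else 0) + bary a j (cellMap a w x)) / 2)
        = (2 : ℝ) ^ w.length * (if i = j then 1 else 0)
          + 2 ^ w.length * bary a j (cellMap a w x) := by ring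
    rw [this, ih]
    split_ifs <;> ring

lemma sum_offset (ha : ∀ i j, i ≠ j → dist (a i) (a j) = 1) (w : List (Fin 3)) :
    ∑ j, offset w j = 2 ^ w.length - 1 := by
  have h := Finset.sum_congr rfl fun j (_ : j ∈ Finset.univ) => bary_cellMap ha w j (a 0)
  rw [← Finset.mul_sum, Finset.sum_add_distrib, sum_bary, sum_bary] at h
  have h2 : ((∑ j, offset w j : ℤ) : ℝ) = ((2 ^ w.length - 1 : ℤ) : ℝ) := by
    push_cast; linarith
  exact_mod_cast h2

/-! ### Self-similarity of the gasket -/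

lemma dist_contraction (i : Fin 3) (x y : Plane) :
    dist (contraction a i x) (contraction a i y) = dist x y / 2 := by
  rw [dist_eq_norm, dist_eq_norm,
    show contraction a i x - contraction a i y = (1 / 2 : ℝ) • (x - y) by
      simp only [contraction]; module, norm_smul]
  norm_num
  ring

lemma contraction_vertex (i : Fin 3) : contraction a i (a i) = a i := by
  simp [contraction]

lemma continuous_contraction (i : Fin 3) : Continuous (contraction a i) := by
  unfold contraction
  fun_prop

lemma dist_cellMap (w : List (Fin 3)) (x y : Plane) :
    dist (cellMap a w x) (cellMap a w y) = dist x y * mesh w.length := by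
  induction w with
  | nil => simp [cellMap, mesh]
  | cons i w ih =>
    simp only [cellMap, Function.comp, dist_contraction, ih, List.length_cons, mesh, pow_succ]
    field_simp

lemma vertexSet_finite (n : ℕ) : (vertexSet a n).Finite := by
  have h : vertexSet a n ⊆
      (fun p : List (Fin 3) × Fin 3 => cellMap a p.1 (a p.2)) ''
        ({w : List (Fin 3) | w.length = n} ×ˢ univ) := by
    rintro x ⟨w, i, hw, rfl⟩
    exact ⟨(w, i), ⟨hw, trivial⟩, rfl⟩
  exact (((List.finite_length_eq _ n).prod finite_univ).image _).subset h

lemma vertex_mem_vertexSet (n : ℕ) (i : Fin 3) : a i ∈ vertexSet a n := by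
  refine ⟨List.replicate n i, i, List.length_replicate, ?_⟩
  induction n with
  | zero => rfl
  | succ n ih =>
    rw [List.replicate_succ, cellMap, Function.comp, ← ih, contraction_vertex]

lemma vertex_mem_gasket (i : Fin 3) : a i ∈ gasket a :=
  subset_closure (mem_iUnion.2 ⟨0, vertex_mem_vertexSet 0 i⟩)

/-- A closed set that contains the three vertices and is stable under the contractions contains the
gasket. -/
lemma gasket_subset {C : Set Plane} (hC : IsClosed C) (h0 : ∀ i, a i ∈ C)
    (h1 : ∀ i, ∀ x ∈ C, contraction a i x ∈ C) : gasket a ⊆ C := by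
  refine closure_minimal (iUnion_subset ?_) hC
  rintro n x ⟨w, i, -, rfl⟩
  induction w with
  | nil => exact h0 i
  | cons j w ih => exact h1 j _ ih

lemma contraction_mem_gasket (i : Fin 3) {x : Plane} (hx : x ∈ gasket a) :
    contraction a i x ∈ gasket a := by
  refine map_mem_closure (continuous_contraction i) hx ?_
  intro y hy
  obtain ⟨n, w, j, hw, rfl⟩ := mem_iUnion.1 hy
  exact mem_iUnion.2 ⟨n + 1, i :: w, j, by simp [hw], rfl⟩

lemma cellMap_mem_gasket (w : List (Fin 3)) {x : Plane} (hx : x ∈ gasket a) :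
    cellMap a w x ∈ gasket a := by
  induction w with
  | nil => exact hx
  | cons i w ih => exact contraction_mem_gasket i ih

lemma isClosed_contraction_image (i : Fin 3) : IsClosed (contraction a i '' gasket a) := by
  have h : contraction a i '' gasket a = (fun y => a i + (2 : ℝ) • (y - a i)) ⁻¹' gasket a := by
    ext y
    constructor
    · rintro ⟨x, hx, rfl⟩
      have : a i + (2 : ℝ) • (contraction a i x - a i) = x := by
        simp only [contraction]; module
      simpa only [mem_preimage, this] using hx
    · intro hy
      exact ⟨_, hy, by simp only [contraction]; module⟩
  rw [h]
  exact isClosed_closure.preimage (by fun_prop)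

lemma exists_contraction_eq {x : Plane} (hx : x ∈ gasket a) :
    ∃ i, ∃ y ∈ gasket a, x = contraction a i y := by
  have h : gasket a ⊆ ⋃ i, contraction a i '' gasket a := by
    refine gasket_subset (isClosed_iUnion_of_finite fun i => isClosed_contraction_image i)
      (fun i => mem_iUnion.2 ⟨i, a i, vertex_mem_gasket i, contraction_vertex i⟩) ?_
    intro i x hx
    obtain ⟨j, y, hy, rfl⟩ := mem_iUnion.1 hx
    exact mem_iUnion.2 ⟨i, _, contraction_mem_gasket j hy, rfl⟩
  obtain ⟨i, y, hy, rfl⟩ := mem_iUnion.1 (h hx)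
  exact ⟨i, y, hy, rfl⟩

lemma exists_cellMap_eq (n : ℕ) {x : Plane} (hx : x ∈ gasket a) :
    ∃ w : List (Fin 3), w.length = n ∧ ∃ y ∈ gasket a, x = cellMap a w y := by
  induction n generalizing x with
  | zero => exact ⟨[], rfl, x, hx, rfl⟩
  | succ n ih =>
    obtain ⟨i, y, hy, rfl⟩ := exists_contraction_eq hx
    obtain ⟨w, hw, z, hz, rfl⟩ := ih hy
    exact ⟨i :: w, by simp [hw], z, hz, rfl⟩

instance : CompactSpace (Gasket a) := by
  have hc : IsCompact (convexHull ℝ (range a)) := (finite_range a).isCompact_convexHull ℝ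
  refine isCompact_iff_compactSpace.1 (hc.of_isClosed_subset isClosed_closure ?_)
  refine gasket_subset hc.isClosed (fun i => subset_convexHull ℝ _ ⟨i, rfl⟩) ?_
  intro i x hx
  have h := (convex_convexHull ℝ (range a)) (subset_convexHull ℝ _ ⟨i, rfl⟩) hx
    (by norm_num : (0 : ℝ) ≤ 1 / 2) (by norm_num : (0 : ℝ) ≤ 1 / 2) (by norm_num)
  convert h using 1
  simp only [contraction]; module

lemma bary_nonneg (ha : ∀ i j, i ≠ j → dist (a i) (a j) = 1) {x : Plane} (hx : x ∈ gasket a)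
    (i : Fin 3) : 0 ≤ bary a i x := by
  have h : gasket a ⊆ {x | 0 ≤ bary a i x} := by
    refine gasket_subset (isClosed_le continuous_const (continuous_bary i)) (fun j => ?_) ?_
    · simp only [mem_ofPred_eq, bary_vertex ha]; split_ifs <;> norm_num
    · intro j x hx
      simp only [mem_ofPred_eq, bary_contraction ha] at hx ⊢
      split_ifs <;> linarith
  exact h hx

lemma sum_bary_smul (ha : ∀ i j, i ≠ j → dist (a i) (a j) = 1) {x : Plane}
    (hx : x ∈ gasket a) : x = ∑ i, bary a i x • a i := by
  have h : gasket a ⊆ {x | x = ∑ i, bary a i x • a i} := by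
    refine gasket_subset (isClosed_eq continuous_id ?_) (fun j => ?_) ?_
    · exact continuous_finsetSum _ fun i _ => (continuous_bary i).smul continuous_const
    · simp [bary_vertex ha]
    · intro j x hx
      simp only [mem_ofPred_eq, bary_contraction ha] at hx ⊢
      have h2 : ∑ i, (((if j = i then (1 : ℝ) else 0) + bary a i x) / 2) • a i
          = (1 / 2 : ℝ) • a j + (1 / 2 : ℝ) • ∑ i, bary a i x • a i := by
        rw [Finset.smul_sum]
        simp only [add_div, add_smul, Finset.sum_add_distrib]
        congr 1
        · rw [Finset.sum_eq_single j] <;> simp +contextual [eq_comm]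
        · refine Finset.sum_congr rfl fun i _ => ?_
          module
      rw [h2, ← hx, contraction]
      module
  exact h hx

lemma eq_of_bary_eq (ha : ∀ i j, i ≠ j → dist (a i) (a j) = 1) {x y : Plane}
    (hx : x ∈ gasket a) (hy : y ∈ gasket a) (h : ∀ i, bary a i x = bary a i y) : x = y := by
  rw [sum_bary_smul ha hx, sum_bary_smul ha hy]
  simp [h]

lemma bary_lt_one (ha : ∀ i j, i ≠ j → dist (a i) (a j) = 1) {x : Plane} (hx : x ∈ gasket a)
    {i : Fin 3} (hi : x ≠ a i) : bary a i x < 1 := by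
  by_contra! h
  refine hi (eq_of_bary_eq ha hx (vertex_mem_gasket i) ?_)
  have h0 := sum_bary (a := a) x
  rw [Fin.sum_univ_three] at h0
  have h1 := bary_nonneg ha hx 0
  have h2 := bary_nonneg ha hx 1
  have h3 := bary_nonneg ha hx 2
  intro j
  rw [bary_vertex ha]
  fin_cases i <;> fin_cases j <;> simp at h ⊢ <;> linarith

/-! ### Passages between vertices -/

lemma bdry_subset_vertices (n : ℕ) : bdry a ⊆ vertices a n := by
  rintro x ⟨i, hi⟩
  change (x : Plane) ∈ vertexSet a n
  rw [hi]
  exact vertex_mem_vertexSet n i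

lemma vertices_finite (n : ℕ) : (vertices a n).Finite :=
  (vertexSet_finite n).preimage Subtype.val_injective.injOn

instance (n : ℕ) : Finite (vertices a n) := (vertices_finite n).to_subtype

lemma bdry_finite : (bdry a).Finite := (vertices_finite 0).subset (bdry_subset_vertices 0)

instance : Finite (bdry a) := bdry_finite.to_subtype

/-- The `i`-th vertex of the initial triangle, as a point of the gasket. -/
def corner (a : Fin 3 → Plane) (i : Fin 3) : Gasket a := ⟨a i, vertex_mem_gasket i⟩

lemma corner_mem_bdry (i : Fin 3) : corner a i ∈ bdry a := ⟨i, rfl⟩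

instance : Nonempty (bdry a) := ⟨⟨corner a 0, corner_mem_bdry 0⟩⟩

instance : Nonempty (Gasket a) := ⟨corner a 0⟩

lemma Adj.symm {n : ℕ} {x y : Plane} (h : Adj a n x y) : Adj a n y x := by
  obtain ⟨w, i, j, hw, hij, rfl, rfl⟩ := h
  exact ⟨w, j, i, hw, hij.symm, rfl, rfl⟩

lemma Adj.dist_eq (ha : ∀ i j, i ≠ j → dist (a i) (a j) = 1) {n : ℕ} {x y : Plane}
    (h : Adj a n x y) : dist x y = mesh n := by
  obtain ⟨w, i, j, hw, hij, rfl, rfl⟩ := h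
  rw [dist_cellMap, ha i j hij, hw, one_mul]

lemma mesh_pos (n : ℕ) : 0 < mesh n := by unfold mesh; positivity

lemma Adj.ne (ha : ∀ i j, i ≠ j → dist (a i) (a j) = 1) {n : ℕ} {x y : Plane}
    (h : Adj a n x y) : x ≠ y := by
  rw [← dist_pos, h.dist_eq ha]
  exact mesh_pos n

lemma exists_adj (n : ℕ) (x : vertices a n) : ∃ y : vertices a n, Adj a n (y : Gasket a) x := by
  obtain ⟨w, i, hw, hx⟩ := x.2
  exact ⟨⟨⟨cellMap a w (a (i + 1)), cellMap_mem_gasket w (vertex_mem_gasket _)⟩, w, _, hw, rfl⟩,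
    w, _, i, hw, by simp, rfl, hx⟩

lemma exists_eq_add_ite {k m : Fin 3 → ℤ} (h1 : ∀ j, k j ≤ m j) (h2 : ∀ j, m j ≤ k j + 1)
    (h : ∑ j, m j = ∑ j, k j + 1) : ∃ i, ∀ j, m j = k j + if i = j then 1 else 0 := by
  simp only [Fin.sum_univ_three] at h
  have a0 := h1 0
  have a1 := h1 1
  have a2 := h1 2
  have b0 := h2 0
  have b1 := h2 1
  have b2 := h2 2
  by_cases c0 : m 0 = k 0 + 1
  · exact ⟨0, fun j => by fin_cases j <;> simp <;> omega⟩
  by_cases c1 : m 1 = k 1 + 1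
  · exact ⟨1, fun j => by fin_cases j <;> simp <;> omega⟩
  · exact ⟨2, fun j => by fin_cases j <;> simp <;> omega⟩

/-- A vertex of level `n` whose coordinates lie in the range of a cell is a corner of this cell. -/
lemma exists_eq_cellMap_vertex (ha : ∀ i j, i ≠ j → dist (a i) (a j) = 1) (w : List (Fin 3))
    {z : Plane} (hz : z ∈ vertexSet a w.length)
    (h1 : ∀ j, (offset w j : ℝ) ≤ 2 ^ w.length * bary a j z)
    (h2 : ∀ j, 2 ^ w.length * bary a j z ≤ offset w j + 1) : ∃ i, z = cellMap a w (a i) := by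
  obtain ⟨v, l, hv, rfl⟩ := hz
  have hb : ∀ j, 2 ^ w.length * bary a j (cellMap a v (a l))
      = ((offset v j + if l = j then 1 else 0 : ℤ) : ℝ) := by
    intro j
    rw [← hv, bary_cellMap ha, bary_vertex ha]
    push_cast
    rfl
  simp only [hb] at h1 h2
  obtain ⟨i, hi⟩ := exists_eq_add_ite (k := offset w)
    (m := fun j => offset v j + if l = j then 1 else 0)
    (fun j => by exact_mod_cast h1 j) (fun j => by exact_mod_cast h2 j) (by
      rw [Finset.sum_add_distrib, sum_offset ha, sum_offset ha, hv]
      simp)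
  refine ⟨i, eq_of_bary_eq ha (cellMap_mem_gasket _ (vertex_mem_gasket _))
    (cellMap_mem_gasket _ (vertex_mem_gasket _)) fun j => ?_⟩
  have h2n : (2 : ℝ) ^ w.length ≠ 0 := by positivity
  apply mul_left_cancel₀ h2n
  rw [hb, hi, bary_cellMap ha, bary_vertex ha]
  push_cast
  rfl

/-- Between two consecutive visits to the level `n` vertices, a curve stays in one cell. The integer
part of the rescaled barycentric coordinates names the cell, and off the level `n` vertices this
integer part is locally constant. -/
lemma adj_of_passage (ha : ∀ i j, i ≠ j → dist (a i) (a j) = 1) {n : ℕ} {ξ : ℝ → Gasket a}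
    (hξ : Continuous ξ) {s t : ℝ} (hst : s < t) (hs : ξ s ∈ vertices a n) (ht : ξ t ∈ vertices a n)
    (hne : ξ s ≠ ξ t) (hv : ∀ r ∈ Ioo s t, ξ r ∉ vertices a n) : Adj a n (ξ s) (ξ t) := by
  have hcont : ∀ j, Continuous fun r => 2 ^ n * bary a j (ξ r) := fun j =>
    continuous_const.mul ((continuous_bary j).comp (continuous_subtype_val.comp hξ))
  -- every point of the curve lies in some cell of level `n`
  have hcell : ∀ r, ∃ k : Fin 3 → ℤ, ∑ j, k j = 2 ^ n - 1 ∧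
      (∀ j, (k j : ℝ) ≤ 2 ^ n * bary a j (ξ r)) ∧
      (r ∈ Ioo s t → ∀ j, 2 ^ n * bary a j (ξ r) < k j + 1) ∧ ∃ w, w.length = n ∧ k = offset w := by
    intro r
    obtain ⟨w, rfl, y, hy, hxy⟩ := exists_cellMap_eq n (ξ r).2
    refine ⟨offset w, sum_offset ha w, fun j => ?_, fun hr j => ?_, w, rfl, rfl⟩
    · rw [hxy, bary_cellMap ha]
      linarith [bary_nonneg ha hy j]
    · rw [hxy, bary_cellMap ha]
      have : y ≠ a j := by
        rintro rfl
        exact hv r hr ⟨w, j, rfl, hxy⟩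
      linarith [bary_lt_one ha hy this]
  obtain ⟨m, hm⟩ : (Ioo s t).Nonempty := nonempty_Ioo.2 hst
  obtain ⟨k, hk, hk1, hk2, w, rfl, rfl⟩ := hcell m
  have heq : ∀ k' : Fin 3 → ℤ, ∑ j, k' j = 2 ^ w.length - 1 → (∀ j, k' j ≤ offset w j) →
      k' = offset w := by
    intro k' hk' hle
    funext j
    exact (Finset.sum_eq_sum_iff_of_le fun j _ => hle j).1 (hk'.trans hk.symm) j (Finset.mem_univ j)
  -- within `(s, t)`, the times spent in the cell of `w` form `U`, and the other times form `V`
  let U : Set ℝ := {r | ∀ j, 2 ^ w.length * bary a j (ξ r) < offset w j + 1}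
  let V : Set ℝ := {r | ∃ j, 2 ^ w.length * bary a j (ξ r) < offset w j}
  have hU : IsOpen U := by
    have : U = ⋂ j, {r | 2 ^ w.length * bary a j (ξ r) < offset w j + 1} := by
      ext; simp [U]
    rw [this]
    exact isOpen_iInter_of_finite fun j => isOpen_lt (hcont j) continuous_const
  have hV : IsOpen V := by
    have : V = ⋃ j, {r | 2 ^ w.length * bary a j (ξ r) < offset w j} := by
      ext; simp [V]
    rw [this]
    exact isOpen_iUnion fun j => isOpen_lt (hcont j) continuous_const
  have hUV : Disjoint U V := by
    rw [Set.disjoint_left]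
    rintro r hr ⟨j, hj⟩
    obtain ⟨k', hk', hk1', -, -⟩ := hcell r
    have : k' = offset w := heq k' hk' fun j => by
      have : (k' j : ℝ) < offset w j + 1 := (hk1' j).trans_lt (hr j)
      have : k' j < offset w j + 1 := by exact_mod_cast this
      omega
    subst this
    exact absurd (hk1' j) (not_le.2 hj)
  have hcov : Ioo s t ⊆ U ∪ V := by
    intro r hr
    obtain ⟨k', hk', -, hk2', -⟩ := hcell r
    by_cases h : ∀ j, offset w j ≤ k' j
    · left
      have : offset w = k' := by
        funext j
        exact (Finset.sum_eq_sum_iff_of_le fun j _ => h j).1 (hk.trans hk'.symm) j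
          (Finset.mem_univ j)
      rw [this.symm] at hk2'
      exact hk2' hr
    · right
      push Not at h
      obtain ⟨j, hj⟩ := h
      refine ⟨j, (hk2' hr j).trans_le ?_⟩
      have : k' j + 1 ≤ offset w j := hj
      exact_mod_cast this
  have hsub : Ioo s t ⊆ U :=
    isPreconnected_Ioo.subset_left_of_subset_union hU hV hUV hcov ⟨m, hm, hk2 hm⟩
  have hclosed : IsClosed {r | ∀ j, (offset w j : ℝ) ≤ 2 ^ w.length * bary a j (ξ r) ∧
      2 ^ w.length * bary a j (ξ r) ≤ offset w j + 1} := by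
    have : {r | ∀ j, (offset w j : ℝ) ≤ 2 ^ w.length * bary a j (ξ r) ∧
      2 ^ w.length * bary a j (ξ r) ≤ offset w j + 1} =
      ⋂ j, ({r | (offset w j : ℝ) ≤ 2 ^ w.length * bary a j (ξ r)} ∩
        {r | 2 ^ w.length * bary a j (ξ r) ≤ offset w j + 1}) := by
      ext; simp
    rw [this]
    exact isClosed_iInter fun j => (isClosed_le continuous_const (hcont j)).inter
      (isClosed_le (hcont j) continuous_const)
  have hIcc : Icc s t ⊆ {r | ∀ j, (offset w j : ℝ) ≤ 2 ^ w.length * bary a j (ξ r) ∧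
      2 ^ w.length * bary a j (ξ r) ≤ offset w j + 1} := by
    rw [← closure_Ioo hst.ne]
    refine closure_minimal (fun r hr j => ⟨?_, (hsub hr j).le⟩) hclosed
    by_contra! h
    exact Set.disjoint_left.1 hUV (hsub hr) ⟨j, h⟩
  have h1 := hIcc (left_mem_Icc.2 hst.le)
  have h2 := hIcc (right_mem_Icc.2 hst.le)
  obtain ⟨i, hi⟩ := exists_eq_cellMap_vertex ha w hs (fun j => (h1 j).1) (fun j => (h1 j).2)
  obtain ⟨j, hj⟩ := exists_eq_cellMap_vertex ha w ht (fun j => (h2 j).1) (fun j => (h2 j).2)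
  refine ⟨w, i, j, rfl, ?_, hi, hj⟩
  rintro rfl
  exact hne (Subtype.ext (hi.trans hj.symm))

/-! ### Edges and paths in the gasket -/

/-- The sides of the initial triangle lie in the gasket, because each half of a side is the image of
the side under a contraction. -/
lemma lineMap_mem_gasket (ha : ∀ i j, i ≠ j → dist (a i) (a j) = 1) {i j : Fin 3} (hij : i ≠ j)
    {t : ℝ} (ht : t ∈ Icc (0 : ℝ) 1) : AffineMap.lineMap (a i) (a j) t ∈ gasket a := by
  have key : ∀ n : ℕ, ∀ t ∈ Icc (0 : ℝ) 1,
      ∃ y ∈ gasket a, dist (AffineMap.lineMap (a i) (a j) t) y ≤ (1 / 2) ^ n := by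
    intro n
    induction n with
    | zero =>
      intro t ht
      refine ⟨a i, vertex_mem_gasket i, ?_⟩
      rw [dist_lineMap_left, ha i j hij, Real.norm_eq_abs, abs_of_nonneg ht.1]
      simpa using ht.2
    | succ n ih =>
      intro t ht
      have step : ∀ l, ∀ s ∈ Icc (0 : ℝ) 1, contraction a l (AffineMap.lineMap (a i) (a j) s)
          = AffineMap.lineMap (a i) (a j) t →
          ∃ y ∈ gasket a, dist (AffineMap.lineMap (a i) (a j) t) y ≤ (1 / 2) ^ (n + 1) := by
        intro l s hs h
        obtain ⟨y, hy, hd⟩ := ih s hs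
        refine ⟨_, contraction_mem_gasket l hy, ?_⟩
        rw [← h, dist_contraction, pow_succ]
        linarith
      rcases le_total t (1 / 2) with h | h
      · refine step i (2 * t) ⟨by linarith [ht.1], by linarith⟩ ?_
        simp only [contraction, AffineMap.lineMap_apply_module]; module
      · refine step j (2 * t - 1) ⟨by linarith, by linarith [ht.2]⟩ ?_
        simp only [contraction, AffineMap.lineMap_apply_module]; module
  have hcl : IsClosed (gasket a) := isClosed_closure
  rw [← hcl.closure_eq, Metric.mem_closure_iff]
  intro ε hε
  obtain ⟨n, hn⟩ := exists_pow_lt_of_lt_one hε (by norm_num : (1 / 2 : ℝ) < 1)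
  obtain ⟨y, hy, hd⟩ := key n t ht
  exact ⟨y, hy, hd.trans_lt hn⟩

lemma exists_curve_corner (ha : ∀ i j, i ≠ j → dist (a i) (a j) = 1) (i j : Fin 3) :
    ∃ η : ℝ → Gasket a, LipschitzWith 1 η ∧ η 0 = corner a i ∧ η 1 = corner a j := by
  rcases eq_or_ne i j with rfl | hij
  · exact ⟨fun _ => corner a i, LipschitzWith.const' _, rfl, rfl⟩
  refine ⟨fun t => ⟨AffineMap.lineMap (a i) (a j) (projIcc (0 : ℝ) 1 zero_le_one t : ℝ),
    lineMap_mem_gasket ha hij (projIcc (0 : ℝ) 1 zero_le_one t).2⟩, ?_, ?_, ?_⟩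
  · refine lipschitzWith_one_iff.2 fun s t => ?_
    rw [Subtype.dist_eq, dist_lineMap_lineMap, ha i j hij, mul_one]
    exact lipschitzWith_one_iff.1 (LipschitzWith.projIcc zero_le_one) s t
  · ext1
    simp [corner]
  · ext1
    simp [corner]

/-- Transport of a curve by a cell map. The time is rescaled like the space, which preserves the
bound on the speed. -/
lemma exists_curve_cellMap (w : List (Fin 3)) {ξ : ℝ → Gasket a} (hξ : LipschitzWith 1 ξ) :
    ∃ η : ℝ → Gasket a, LipschitzWith 1 η ∧
      ∀ t, (η (t * mesh w.length) : Plane) = cellMap a w (ξ t) := by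
  have hm := mesh_pos w.length
  refine ⟨fun t => ⟨cellMap a w (ξ (t / mesh w.length)), cellMap_mem_gasket w (ξ _).2⟩, ?_, ?_⟩
  · refine lipschitzWith_one_of_le fun s t hst => ?_
    rw [Subtype.dist_eq, dist_cellMap]
    have h := dist_le_sub_of_lipschitzWith hξ (div_le_div_of_nonneg_right hst hm.le)
    rw [Subtype.dist_eq] at h
    refine (mul_le_mul_of_nonneg_right h hm.le).trans_eq ?_
    field_simp
  · intro t
    simp [hm.ne']

lemma Adj.exists_curve (ha : ∀ i j, i ≠ j → dist (a i) (a j) = 1) {n : ℕ} {x y : Gasket a}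
    (h : Adj a n x y) : ∃ η : ℝ → Gasket a, LipschitzWith 1 η ∧ η 0 = x ∧ η (mesh n) = y := by
  obtain ⟨w, i, j, rfl, -, hx, hy⟩ := h
  obtain ⟨ξ, hξ, h0, h1⟩ := exists_curve_corner ha i j
  obtain ⟨η, hη, h⟩ := exists_curve_cellMap w hξ
  refine ⟨η, hη, Subtype.ext ?_, Subtype.ext ?_⟩
  · have := h 0
    rwa [zero_mul, h0, corner, ← hx] at this
  · have := h 1
    rwa [one_mul, h1, corner, ← hy] at this

/-- Every point of the gasket is joined to a corner by a curve of speed at most one, in unit time.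
The curves of speed at most one form a compact set for pointwise convergence, so the set of the
starting points of such curves is closed; it contains the corners and is stable under the
contractions. -/
lemma exists_curve_to_corner (ha : ∀ i j, i ≠ j → dist (a i) (a j) = 1) (x : Gasket a) :
    ∃ ξ : ℝ → Gasket a, LipschitzWith 1 ξ ∧ ξ 0 = x ∧ ξ 1 = corner a 0 := by
  let K : Set (ℝ → Gasket a) := {ξ | LipschitzWith 1 ξ ∧ ξ 1 = corner a 0}
  have hK : IsClosed K := by
    have : K = (⋂ s, ⋂ t, {ξ : ℝ → Gasket a | dist (ξ s) (ξ t) ≤ |s - t|}) ∩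
        {ξ | ξ 1 = corner a 0} := by
      ext ξ
      simp [K, lipschitzWith_one_iff]
    rw [this]
    refine (isClosed_iInter fun s => isClosed_iInter fun t => ?_).inter
      (isClosed_eq (continuous_apply 1) continuous_const)
    exact isClosed_le ((continuous_apply s).dist (continuous_apply t)) continuous_const
  have hJ : IsClosed ((fun ξ : ℝ → Gasket a => (ξ 0 : Plane)) '' K) :=
    (hK.isCompact.image (continuous_subtype_val.comp (continuous_apply 0))).isClosed
  have hsub : gasket a ⊆ (fun ξ : ℝ → Gasket a => (ξ 0 : Plane)) '' K := by
    refine gasket_subset hJ (fun i => ?_) ?_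
    · obtain ⟨η, hη, h0, h1⟩ := exists_curve_corner ha i 0
      exact ⟨η, ⟨hη, h1⟩, by simp [h0, corner]⟩
    · rintro i x ⟨ξ, ⟨hξ, h1⟩, rfl⟩
      obtain ⟨η, hη, h⟩ := exists_curve_cellMap [i] hξ
      obtain ⟨ζ, hζ, hζ0, hζ1⟩ : ∃ ζ : ℝ → Gasket a, LipschitzWith 1 ζ ∧
          (ζ 0 : Plane) = contraction a i (a 0) ∧ ζ (1 / 2) = corner a 0 := by
        obtain ⟨ζ', hζ', h0', h1'⟩ := exists_curve_corner ha i 0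
        obtain ⟨ζ, hζ, h'⟩ := exists_curve_cellMap [0] hζ'
        refine ⟨ζ, hζ, ?_, Subtype.ext ?_⟩
        · have := h' 0
          rw [zero_mul, h0'] at this
          rw [this]
          simp only [cellMap, corner, Function.comp, id, contraction]; module
        · have := h' 1
          rw [h1'] at this
          simpa [mesh, cellMap, corner, contraction_vertex] using this
      refine ⟨fun r => if r ≤ 1 / 2 then η r else ζ (r + -(1 / 2)),
        ⟨lipschitzWith_glue hη (lipschitzWith_one_add_right hζ _) (Subtype.ext ?_), ?_⟩, ?_⟩
      · have := h 1
        rw [h1] at this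
        simpa [hζ0, mesh, cellMap, corner] using this
      · norm_num
        simpa using hζ1
      · have := h 0
        simpa [cellMap] using this
  obtain ⟨ξ, ⟨hξ, h1⟩, h0⟩ := hsub x.2
  exact ⟨ξ, hξ, Subtype.ext h0, h1⟩

/-! ### The geodesic distance and admissible curves -/

/-- A curve parametrised by an interval of the line, as a path. -/
def segmentPath {ξ : ℝ → Gasket a} (hξ : Continuous ξ) (s t : ℝ) : Path (ξ s) (ξ t) where
  toFun r := ξ (s + r * (t - s))
  continuous_toFun := by fun_prop
  source' := by simp
  target' := by simp

/-- The variation of a curve is at most the increment of a monotone function that controls its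
oscillation. -/
lemma eVariationOn_segmentPath_le {ξ : ℝ → Gasket a} (hξ : Continuous ξ) {s t : ℝ} (hst : s ≤ t)
    {φ : ℝ → ℝ} (hφ : ∀ p q, p ≤ q → dist (ξ p) (ξ q) ≤ φ q - φ p) :
    eVariationOn (segmentPath hξ s t) univ ≤ ENNReal.ofReal (φ t - φ s) := by
  set θ : unitInterval → ℝ := fun r => φ (s + r * (t - s)) with hθ
  have hpar : ∀ p q : unitInterval, p ≤ q →
      s + (p : ℝ) * (t - s) ≤ s + (q : ℝ) * (t - s) := by
    intro p q hpq
    have : (p : ℝ) ≤ q := hpq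
    have := mul_le_mul_of_nonneg_right this (sub_nonneg.2 hst)
    linarith
  have hdist : ∀ p q : unitInterval, p ≤ q →
      dist (segmentPath hξ s t p) (segmentPath hξ s t q) ≤ θ q - θ p :=
    fun p q hpq => hφ _ _ (hpar p q hpq)
  have hmono : MonotoneOn θ univ := by
    intro p _ q _ hpq
    linarith [hdist p q hpq, dist_nonneg (x := segmentPath hξ s t p) (y := segmentPath hξ s t q)]
  have h1 : eVariationOn (segmentPath hξ s t) univ ≤ eVariationOn θ univ := by
    refine iSup_le fun p => ?_
    refine (Finset.sum_le_sum fun i _ => ?_).trans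
      (eVariationOn.sum_le (f := θ) (s := univ) (n := p.1) p.2.2.1 fun _ => mem_univ _)
    have h := hdist _ _ (p.2.2.1 (Nat.le_succ i))
    rw [edist_dist, edist_dist, dist_comm]
    refine ENNReal.ofReal_le_ofReal (h.trans ?_)
    rw [Real.dist_eq]
    exact le_abs_self _
  refine h1.trans ?_
  have h2 := (hmono.eVariationOn_eq (mem_univ (0 : unitInterval)) (mem_univ (1 : unitInterval))).le
  have h3 : univ ∩ Icc (0 : unitInterval) 1 = univ := by
    ext r
    simp [unitInterval.le_one']
  rw [h3] at h2
  simpa [hθ] using h2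

lemma geodist_le_of_dist_le {ξ : ℝ → Gasket a} (hξ : Continuous ξ) {s t : ℝ} (hst : s ≤ t)
    {φ : ℝ → ℝ} (hφ : ∀ p q, p ≤ q → dist (ξ p) (ξ q) ≤ φ q - φ p) :
    geodist a (ξ s) (ξ t) ≤ φ t - φ s := by
  have h0 : 0 ≤ φ t - φ s := dist_nonneg.trans (hφ s t hst)
  refine ENNReal.toReal_le_of_le_ofReal h0 ?_
  exact (iInf_le _ (segmentPath hξ s t)).trans (eVariationOn_segmentPath_le hξ hst hφ)

lemma exists_curve_joining (ha : ∀ i j, i ≠ j → dist (a i) (a j) = 1) (x y : Gasket a) :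
    ∃ ξ : ℝ → Gasket a, LipschitzWith 1 ξ ∧ ξ 0 = x ∧ ξ 2 = y := by
  obtain ⟨ξ, hξ, h0, h1⟩ := exists_curve_to_corner ha x
  obtain ⟨η, hη, k0, k1⟩ := exists_curve_to_corner ha y
  have hr : LipschitzWith 1 fun r : ℝ => 2 - r :=
    lipschitzWith_one_iff.2 fun s t => by
      rw [Real.dist_eq, abs_sub_comm s t]
      exact (congrArg _ (by ring)).le
  refine ⟨fun r => if r ≤ 1 then ξ r else η (2 - r),
    lipschitzWith_glue hξ (lipschitzWith_one_comp hη hr) ?_, by simp [h0], by norm_num [k0]⟩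
  norm_num [h1, k1]

lemma dist_le_geodist (ha : ∀ i j, i ≠ j → dist (a i) (a j) = 1) (x y : Gasket a) :
    dist x y ≤ geodist a x y := by
  -- a path of finite length is needed here: the infimum `∞` would turn into the distance `0`
  have hfin : (⨅ γ : Path x y, eVariationOn γ Set.univ) ≠ ⊤ := by
    obtain ⟨ξ, hξ, rfl, rfl⟩ := exists_curve_joining ha x y
    refine ne_top_of_le_ne_top ENNReal.ofReal_ne_top
      ((iInf_le _ (segmentPath hξ.continuous 0 2)).trans
      (eVariationOn_segmentPath_le hξ.continuous (φ := fun t => t) (by norm_num) ?_))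
    exact fun p q hpq => dist_le_sub_of_lipschitzWith hξ hpq
  rw [geodist, dist_edist]
  refine ENNReal.toReal_mono hfin (le_iInf fun γ => ?_)
  simpa using eVariationOn.edist_le γ (mem_univ (0 : unitInterval)) (mem_univ 1)

lemma geodist_comm (x y : Gasket a) : geodist a x y = geodist a y x := by
  have h : ∀ x y : Gasket a, (⨅ γ : Path x y, eVariationOn γ Set.univ)
      ≤ ⨅ γ : Path y x, eVariationOn γ Set.univ := by
    intro x y
    refine le_iInf fun γ => (iInf_le _ γ.symm).trans ?_
    exact eVariationOn.comp_le_of_antitoneOn γ unitInterval.symm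
      (fun _ _ _ _ h => by simpa using h) (fun _ _ => mem_univ _)
  exact congrArg ENNReal.toReal (le_antisymm (h x y) (h y x))

/-- Admissible curves have speed at most one for the Euclidean distance. -/
lemma IsAdmissible.dist_le (ha : ∀ i j, i ≠ j → dist (a i) (a j) = 1) {I : Set ℝ}
    {Ω : Set (Gasket a)} {ξ : ℝ → Gasket a} (h : IsAdmissible a I Ω ξ) (hI : I.OrdConnected)
    {s t : ℝ} (hs : s ∈ I) (ht : t ∈ I) (hst : s ≤ t) : dist (ξ s) (ξ t) ≤ t - s := by
  obtain ⟨-, m, hm, -, hint, hle⟩ := h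
  refine (dist_le_geodist ha _ _).trans ((hint s hs t ht hst).trans ?_)
  have hsub : Icc s t ⊆ I := hI.out hs ht
  have hii : IntervalIntegrable m volume s t :=
    (intervalIntegrable_iff_integrableOn_Icc_of_le hst).2
      (hm.integrableOn_compact_subset hsub isCompact_Icc)
  calc ∫ r in s..t, m r ≤ ∫ r in s..t, (1 : ℝ) := by
        refine intervalIntegral.integral_mono_ae_restrict hst hii (by simp) ?_
        rw [EventuallyLE, ae_restrict_iff' measurableSet_Icc]
        filter_upwards [hle] with r hr hrI using hr (hsub hrI)
    _ = t - s := by simp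

/-- Between two times, an admissible curve is part of a curve of speed at most one on the line. -/
lemma IsAdmissible.exists_lipschitzWith (ha : ∀ i j, i ≠ j → dist (a i) (a j) = 1) {I : Set ℝ}
    {Ω : Set (Gasket a)} {ξ : ℝ → Gasket a} (h : IsAdmissible a I Ω ξ) (hI : I.OrdConnected)
    {s t : ℝ} (hs : s ∈ I) (ht : t ∈ I) (hst : s ≤ t) :
    ∃ η : ℝ → Gasket a, LipschitzWith 1 η ∧ ∀ r ∈ Icc s t, η r = ξ r := by
  refine ⟨fun r => ξ (projIcc s t hst r), lipschitzWith_one_of_le fun p q hpq => ?_, fun r hr => ?_⟩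
  · have hmem : ∀ r, (projIcc s t hst r : ℝ) ∈ I := fun r => hI.out hs ht (projIcc s t hst r).2
    have hle : (projIcc s t hst p : ℝ) ≤ projIcc s t hst q := monotone_projIcc hst hpq
    refine (h.dist_le ha hI (hmem p) (hmem q) hle).trans ?_
    have := dist_le_sub_of_lipschitzWith (LipschitzWith.projIcc hst) hpq
    rw [dist_comm, Subtype.dist_eq, Real.dist_eq] at this
    exact (le_abs_self _).trans this
  · simp [projIcc_of_mem hst hr]

lemma norm_sub_le_integral_norm_deriv {ζ : ℝ → Plane} (hζ : LipschitzWith 1 ζ) {s t : ℝ}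
    (hst : s ≤ t) : ‖ζ t - ζ s‖ ≤ ∫ r in s..t, ‖deriv ζ r‖ := by
  set e : Plane := ζ t - ζ s with he
  have hmeas : AEStronglyMeasurable (fun r => ‖deriv ζ r‖) (volume.restrict (uIoc s t)) :=
    (measurable_deriv ζ).norm.aestronglyMeasurable
  have hbd : ∀ r, ‖deriv ζ r‖ ≤ 1 := fun r => by simpa using norm_deriv_le_of_lipschitz (x₀ := r) hζ
  have hii : IntervalIntegrable (fun r => ‖deriv ζ r‖) volume s t :=
    (intervalIntegrable_const (c := (1 : ℝ))).mono_fun hmeas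
      (Eventually.of_forall fun r => by simpa using hbd r)
  -- the scalar function `⟨e, ζ⟩` is absolutely continuous
  set φ : ℝ → ℝ := fun r => inner ℝ e (ζ r) with hφ
  have hφL : LipschitzWith ‖e‖₊ φ := by
    refine LipschitzWith.of_dist_le_mul fun p q => ?_
    rw [Real.dist_eq, hφ, ← inner_sub_right]
    refine (abs_real_inner_le_norm _ _).trans ?_
    have := hζ.dist_le_mul p q
    rw [dist_eq_norm, NNReal.coe_one, one_mul] at this
    exact mul_le_mul_of_nonneg_left this (norm_nonneg _)
  have hac := (hφL.lipschitzOnWith (s := uIcc s t)).absolutelyContinuousOnInterval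
  have hftc := hac.integral_deriv_eq_sub
  have hle : ∀ᵐ r, deriv φ r ≤ ‖e‖ * ‖deriv ζ r‖ := by
    filter_upwards [hζ.ae_differentiableAt_real] with r hr
    have : HasDerivAt φ (inner ℝ e (deriv ζ r)) r := by
      simpa using (hasDerivAt_const r e).inner ℝ hr.hasDerivAt
    rw [this.deriv]
    exact real_inner_le_norm _ _
  have hφi : IntervalIntegrable (deriv φ) volume s t := hac.intervalIntegrable_deriv
  have hsq : ‖e‖ * ‖e‖ ≤ ‖e‖ * ∫ r in s..t, ‖deriv ζ r‖ := by
    rw [← intervalIntegral.integral_const_mul]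
    calc ‖e‖ * ‖e‖ = φ t - φ s := by
          rw [← real_inner_self_eq_norm_mul_norm, hφ, ← inner_sub_right]
      _ = ∫ r in s..t, deriv φ r := hftc.symm
      _ ≤ _ := intervalIntegral.integral_mono_ae hst hφi (hii.const_mul _) hle
  rcases eq_or_ne e 0 with h0 | h0
  · rw [h0, norm_zero]
    exact intervalIntegral.integral_nonneg hst fun r _ => norm_nonneg _
  · exact le_of_mul_le_mul_left hsq (norm_pos_iff.2 h0)

/-- Curves of speed at most one for the Euclidean distance are admissible: their metric derivative
for the geodesic distance is the norm of their derivative, by the theorems of Rademacher and of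
Lebesgue. -/
lemma isAdmissible_of_lipschitzWith (ha : ∀ i j, i ≠ j → dist (a i) (a j) = 1) {I : Set ℝ}
    {Ω : Set (Gasket a)} {ξ : ℝ → Gasket a} (hξ : LipschitzWith 1 ξ) (hΩ : ∀ t ∈ I, ξ t ∈ Ω) :
    IsAdmissible a I Ω ξ := by
  set ζ : ℝ → Plane := fun t => ξ t with hζdef
  have hζ : LipschitzWith 1 ζ := by
    simpa [Function.comp_def] using LipschitzWith.subtype_val (gasket a) |>.comp hξ
  set m : ℝ → ℝ := fun r => ‖deriv ζ r‖ with hm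
  have hbd : ∀ r, ‖m r‖ ≤ 1 := fun r => by
    simpa [hm] using norm_deriv_le_of_lipschitz (x₀ := r) hζ
  have hloc : LocallyIntegrable m volume :=
    (locallyIntegrable_const (1 : ℝ)).mono (measurable_deriv ζ).norm.aestronglyMeasurable
      (Eventually.of_forall fun r => by simpa using hbd r)
  have hii : ∀ p q, IntervalIntegrable m volume p q := fun p q =>
    (hloc.integrableOn_isCompact isCompact_uIcc).intervalIntegrable
  set φ : ℝ → ℝ := fun t => ∫ r in (0 : ℝ)..t, m r with hφ
  have hφsub : ∀ p q, φ q - φ p = ∫ r in p..q, m r := fun p q => by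
    rw [hφ]
    exact intervalIntegral.integral_interval_sub_left (hii _ _) (hii _ _)
  have hdist : ∀ p q, p ≤ q → dist (ξ p) (ξ q) ≤ φ q - φ p := by
    intro p q hpq
    rw [hφsub, dist_comm, Subtype.dist_eq, dist_eq_norm]
    exact norm_sub_le_integral_norm_deriv hζ hpq
  have hgeo : ∀ p q, p ≤ q → geodist a (ξ p) (ξ q) ≤ φ q - φ p := fun p q hpq =>
    geodist_le_of_dist_le hξ.continuous hpq hdist
  refine ⟨hΩ, m, hloc.locallyIntegrableOn I, ?_, fun s _ t _ hst => ?_, ?_⟩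
  · filter_upwards [hζ.ae_differentiableAt_real, LocallyIntegrable.ae_hasDerivAt_integral hloc]
      with t h1 h2 _
    have h3 : HasDerivAt φ (m t) t := h2 0
    have hmono : 𝓝[I \ {t}] t ≤ 𝓝[≠] t := nhdsWithin_mono t fun s hs => hs.2
    have hlow : Tendsto (fun s => ‖slope ζ t s‖) (𝓝[I \ {t}] t) (𝓝 (m t)) :=
      (h1.hasDerivAt.tendsto_slope.norm).mono_left hmono
    have hupp : Tendsto (fun s => ‖slope φ t s‖) (𝓝[I \ {t}] t) (𝓝 (m t)) := by
      have := (h3.tendsto_slope.norm).mono_left hmono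
      rwa [show ‖m t‖ = m t by simp [hm]] at this
    refine tendsto_of_tendsto_of_tendsto_of_le_of_le hlow hupp (fun s => ?_) (fun s => ?_)
    · simp only [slope, vsub_eq_sub, norm_smul, norm_inv, Real.norm_eq_abs, div_eq_inv_mul]
      refine mul_le_mul_of_nonneg_left ?_ (by positivity)
      have := dist_le_geodist ha (ξ s) (ξ t)
      rwa [Subtype.dist_eq, dist_eq_norm] at this
    · simp only [slope, vsub_eq_sub, norm_smul, norm_inv, Real.norm_eq_abs, div_eq_inv_mul]
      refine mul_le_mul_of_nonneg_left ?_ (by positivity)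
      rcases le_total s t with hst | hst
      · rw [abs_sub_comm]
        exact (hgeo s t hst).trans (le_abs_self _)
      · rw [geodist_comm]
        exact (hgeo t s hst).trans (le_abs_self _)
  · rw [← hφsub]
    exact hgeo s t hst
  · exact Eventually.of_forall fun r _ => (le_abs_self _).trans (hbd r)

/-! ### The value function of the exit problem -/

lemma exists_pos_le {f : Gasket a → ℝ} (hf : Continuous f) (hpos : 0 < ⨅ x, f x) :
    ∃ c > 0, ∀ x, c ≤ f x :=
  ⟨_, hpos, fun x => ciInf_le (isCompact_range hf).bddBelow x⟩

lemma exists_ge (f : Gasket a → ℝ) (hf : Continuous f) : ∃ M, ∀ x, f x ≤ M :=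
  ⟨_, fun x => le_ciSup (isCompact_range hf).bddAbove x⟩

lemma iInf_bdry_le (g : bdry a → ℝ) (y : bdry a) : ⨅ z, g z ≤ g y :=
  ciInf_le (finite_range g).bddBelow y

/-- The costs of the curves of speed at most one from `x` to the boundary. The curves are defined on
the whole line, and the time interval `[0, T]` is the relevant one. -/
def costs (a : Fin 3 → Plane) (f : Gasket a → ℝ) (g : bdry a → ℝ) (x : Gasket a) : Set ℝ :=
  {r | ∃ (ξ : ℝ → Gasket a) (T : ℝ) (y : bdry a), LipschitzWith 1 ξ ∧ 0 ≤ T ∧ ξ 0 = x ∧ ξ T = y ∧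
    r = (∫ t in (0 : ℝ)..T, f (ξ t)) + g y}

/-- The value function: the least cost of reaching the boundary. -/
noncomputable def value (a : Fin 3 → Plane) (f : Gasket a → ℝ) (g : bdry a → ℝ) (x : Gasket a) :
    ℝ :=
  sInf (costs a f g x)

variable {f : Gasket a → ℝ} {g : bdry a → ℝ}

lemma intervalIntegrable_comp {ξ : ℝ → Gasket a} (hf : Continuous f) (hξ : LipschitzWith 1 ξ)
    (s t : ℝ) : IntervalIntegrable (fun r => f (ξ r)) volume s t :=
  (hf.comp hξ.continuous).intervalIntegrable s t

lemma integral_le_mul_sub {M : ℝ} (hf : Continuous f) (hM : ∀ x, f x ≤ M) {ξ : ℝ → Gasket a}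
    (hξ : LipschitzWith 1 ξ) {s t : ℝ} (hst : s ≤ t) : ∫ r in s..t, f (ξ r) ≤ M * (t - s) := by
  have := intervalIntegral.integral_mono_on hst (intervalIntegrable_comp hf hξ s t)
    (intervalIntegrable_const (c := M)) fun r _ => hM (ξ r)
  simpa [mul_comm] using this

lemma mul_sub_le_integral {c : ℝ} (hf : Continuous f) (hc : ∀ x, c ≤ f x) {ξ : ℝ → Gasket a}
    (hξ : LipschitzWith 1 ξ) {s t : ℝ} (hst : s ≤ t) : c * (t - s) ≤ ∫ r in s..t, f (ξ r) := by
  have := intervalIntegral.integral_mono_on hst (intervalIntegrable_const (c := c))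
    (intervalIntegrable_comp hf hξ s t) fun r _ => hc (ξ r)
  simpa [mul_comm] using this

lemma integral_comp_nonneg (h0 : ∀ x, 0 ≤ f x) (ξ : ℝ → Gasket a) {s t : ℝ} (hst : s ≤ t) :
    0 ≤ ∫ r in s..t, f (ξ r) :=
  intervalIntegral.integral_nonneg hst fun r _ => h0 (ξ r)

lemma iInf_mem_lowerBounds_costs (h0 : ∀ x, 0 ≤ f x) (x : Gasket a) :
    ⨅ y, g y ∈ lowerBounds (costs a f g x) := by
  rintro r ⟨ξ, T, y, hξ, hT, -, -, rfl⟩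
  linarith [integral_comp_nonneg h0 ξ hT, iInf_bdry_le g y]

lemma value_le (h0 : ∀ x, 0 ≤ f x) {ξ : ℝ → Gasket a} (hξ : LipschitzWith 1 ξ) {T : ℝ}
    (hT : 0 ≤ T) {y : bdry a} (hy : ξ T = y) :
    value a f g (ξ 0) ≤ (∫ t in (0 : ℝ)..T, f (ξ t)) + g y :=
  csInf_le ⟨_, iInf_mem_lowerBounds_costs h0 _⟩ ⟨ξ, T, y, hξ, hT, rfl, hy, rfl⟩

lemma costs_nonempty (ha : ∀ i j, i ≠ j → dist (a i) (a j) = 1) (x : Gasket a) :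
    (costs a f g x).Nonempty := by
  obtain ⟨ξ, hξ, hx, h1⟩ := exists_curve_to_corner ha x
  exact ⟨_, ξ, 1, ⟨corner a 0, corner_mem_bdry 0⟩, hξ, zero_le_one, hx, h1, rfl⟩

lemma le_value (ha : ∀ i j, i ≠ j → dist (a i) (a j) = 1) {x : Gasket a} {b : ℝ}
    (h : ∀ (ξ : ℝ → Gasket a) (T : ℝ) (y : bdry a), LipschitzWith 1 ξ → 0 ≤ T → ξ 0 = x → ξ T = y →
      b ≤ (∫ t in (0 : ℝ)..T, f (ξ t)) + g y) : b ≤ value a f g x := by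
  refine le_csInf (costs_nonempty ha x) ?_
  rintro r ⟨ξ, T, y, hξ, hT, hx, hy, rfl⟩
  exact h ξ T y hξ hT hx hy

lemma iInf_le_value (ha : ∀ i j, i ≠ j → dist (a i) (a j) = 1) (h0 : ∀ x, 0 ≤ f x)
    (x : Gasket a) : ⨅ y, g y ≤ value a f g x :=
  le_csInf (costs_nonempty ha x) (iInf_mem_lowerBounds_costs h0 x)

lemma value_le_add (ha : ∀ i j, i ≠ j → dist (a i) (a j) = 1) (hf : Continuous f)
    (h0 : ∀ x, 0 ≤ f x) {M : ℝ} (hM : ∀ x, f x ≤ M) (x : Gasket a) :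
    value a f g x ≤ M + g ⟨corner a 0, corner_mem_bdry 0⟩ := by
  obtain ⟨ξ, hξ, rfl, h1⟩ := exists_curve_to_corner ha x
  have h2 := value_le (g := g) h0 hξ zero_le_one
    (y := ⟨corner a 0, corner_mem_bdry 0⟩) h1
  have h3 := integral_le_mul_sub hf hM hξ (zero_le_one (α := ℝ))
  linarith

/-- Dynamic programming: the value decreases along a curve by at most the running cost. -/
lemma value_le_integral_add (ha : ∀ i j, i ≠ j → dist (a i) (a j) = 1) (hf : Continuous f)
    (h0 : ∀ x, 0 ≤ f x) {ξ : ℝ → Gasket a} (hξ : LipschitzWith 1 ξ) {s t : ℝ} (hst : s ≤ t) :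
    value a f g (ξ s) ≤ (∫ r in s..t, f (ξ r)) + value a f g (ξ t) := by
  rw [← sub_le_iff_le_add']
  refine le_value ha fun η T y hη hT hx hy => ?_
  set ζ : ℝ → Gasket a := fun r => if r ≤ t - s then ξ (r + s) else η (r + -(t - s)) with hζdef
  have hζ : LipschitzWith 1 ζ :=
    lipschitzWith_glue (lipschitzWith_one_add_right hξ s)
      (lipschitzWith_one_add_right hη (-(t - s))) (by simp [hx])
  have hst' : 0 ≤ t - s := sub_nonneg.2 hst
  have hζ0 : ζ 0 = ξ s := by simp [hζdef, hst]
  have hζr : ∀ r, t - s ≤ r → ζ r = η (r + -(t - s)) := by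
    intro r hr
    rcases hr.eq_or_lt with rfl | hr
    · simp [hζdef, hx]
    · simp only [hζdef, not_le.2 hr, if_false]
  have h := value_le (g := g) h0 hζ (add_nonneg hst' hT) (y := y)
    (by rw [hζr _ (by linarith), ← hy]; congr 1; ring)
  have h1 : ∫ r in (0 : ℝ)..(t - s), f (ζ r) = ∫ r in s..t, f (ξ r) := by
    calc ∫ r in (0 : ℝ)..(t - s), f (ζ r) = ∫ r in (0 : ℝ)..(t - s), f (ξ (r + s)) := by
          refine intervalIntegral.integral_congr fun r hr => ?_
          rw [uIcc_of_le hst'] at hr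
          simp only [hζdef, hr.2, if_true]
      _ = ∫ r in s..t, f (ξ r) := by
          rw [intervalIntegral.integral_comp_add_right (fun r => f (ξ r))]
          simp
  have h2 : ∫ r in (t - s)..(t - s + T), f (ζ r) = ∫ r in (0 : ℝ)..T, f (η r) := by
    calc ∫ r in (t - s)..(t - s + T), f (ζ r)
        = ∫ r in (t - s)..(t - s + T), f (η (r + -(t - s))) := by
          refine intervalIntegral.integral_congr fun r hr => ?_
          rw [uIcc_of_le (by linarith)] at hr
          simp only [hζr r hr.1]
      _ = ∫ r in (0 : ℝ)..T, f (η r) := by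
          rw [intervalIntegral.integral_comp_add_right (fun r => f (η r))]
          congr 1 <;> ring
  rw [hζ0, ← intervalIntegral.integral_add_adjacent_intervals
    (intervalIntegrable_comp hf hζ 0 (t - s)) (intervalIntegrable_comp hf hζ _ _), h1, h2] at h
  linarith

lemma value_le_integral_add' (ha : ∀ i j, i ≠ j → dist (a i) (a j) = 1) (hf : Continuous f)
    (h0 : ∀ x, 0 ≤ f x) {ξ : ℝ → Gasket a} (hξ : LipschitzWith 1 ξ) {s t : ℝ} (hst : s ≤ t) :
    value a f g (ξ t) ≤ (∫ r in s..t, f (ξ r)) + value a f g (ξ s) := by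
  have hneg : LipschitzWith 1 fun r : ℝ => -r :=
    lipschitzWith_one_iff.2 fun s t => by rw [dist_neg_neg, Real.dist_eq]
  have h := value_le_integral_add (g := g) ha hf h0 (lipschitzWith_one_comp hξ hneg)
    (neg_le_neg hst)
  simpa [intervalIntegral.integral_comp_neg (fun r => f (ξ r))] using h

lemma value_bdry (ha : ∀ i j, i ≠ j → dist (a i) (a j) = 1) (h0 : ∀ x, 0 ≤ f x)
    (hS : CompatGasket a f g) (y : bdry a) : value a f g y = g y := by
  refine le_antisymm ?_ (le_value ha fun ξ T z hξ hT hx hz => ?_)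
  · simpa using value_le (g := g) h0 (LipschitzWith.const' (y : Gasket a)) le_rfl
      (ξ := fun _ => (y : Gasket a)) (y := y) rfl
  · exact hS y z T ξ hT (isAdmissible_of_lipschitzWith ha hξ fun _ _ => mem_univ _) hx hz

lemma abs_value_sub_le (ha : ∀ i j, i ≠ j → dist (a i) (a j) = 1) (hf : Continuous f)
    (h0 : ∀ x, 0 ≤ f x) {M : ℝ} (hM : ∀ x, f x ≤ M) {ξ : ℝ → Gasket a} (hξ : LipschitzWith 1 ξ)
    {s t : ℝ} (hst : s ≤ t) : |value a f g (ξ s) - value a f g (ξ t)| ≤ M * (t - s) := by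
  have h1 := value_le_integral_add (g := g) ha hf h0 hξ hst
  have h2 := value_le_integral_add' (g := g) ha hf h0 hξ hst
  have h3 := integral_le_mul_sub hf hM hξ hst
  rw [abs_le]
  constructor <;> linarith

/-! ### The value function is a metric viscosity solution -/

lemma continuousOn_value_comp (ha : ∀ i j, i ≠ j → dist (a i) (a j) = 1) (hf : Continuous f)
    (h0 : ∀ x, 0 ≤ f x) {I : Set ℝ} {Ω : Set (Gasket a)} {ξ : ℝ → Gasket a}
    (hI : I.OrdConnected) (h : IsAdmissible a I Ω ξ) :
    ContinuousOn (fun t => value a f g (ξ t)) I := by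
  obtain ⟨M, hM⟩ := exists_ge f hf
  have hle : ∀ s ∈ I, ∀ t ∈ I, s ≤ t →
      |value a f g (ξ s) - value a f g (ξ t)| ≤ M * (t - s) := by
    intro s hs t ht hst
    obtain ⟨η, hη, heq⟩ := h.exists_lipschitzWith ha hI hs ht hst
    rw [← heq s (left_mem_Icc.2 hst), ← heq t (right_mem_Icc.2 hst)]
    exact abs_value_sub_le ha hf h0 hM hη hst
  have hM0 : 0 ≤ M := (h0 (corner a 0)).trans (hM _)
  refine (LipschitzOnWith.of_dist_le_mul (K := ⟨M, hM0⟩) fun s hs t ht => ?_).continuousOn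
  rw [Real.dist_eq, Real.dist_eq]
  rcases le_total s t with hst | hst
  · rw [abs_sub_comm s t, abs_of_nonneg (sub_nonneg.2 hst)]
    exact hle s hs t ht hst
  · rw [abs_sub_comm, abs_of_nonneg (sub_nonneg.2 hst)]
    exact hle t ht s hs hst

lemma exists_pos_of_eventually {t : ℝ} {P : ℝ → Prop} (h : ∀ᶠ s in 𝓝 t, P s) :
    ∃ δ > 0, P (t + δ) ∧ P (t - δ) := by
  obtain ⟨r, hr, h⟩ := Metric.eventually_nhds_iff.1 h
  have h2 : |r / 2| < r := by rw [abs_of_pos (half_pos hr)]; linarith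
  exact ⟨r / 2, half_pos hr, h (by simpa only [Real.dist_eq, add_sub_cancel_left] using h2),
    h (by simpa only [Real.dist_eq, sub_sub_cancel_left, abs_neg] using h2)⟩

lemma abs_le_of_mem_superdiff {w : ℝ → ℝ} {t p K : ℝ} (hp : p ∈ superdiff w t)
    (h : ∀ ε > 0, ∀ᶠ s in 𝓝 t, w t - (K + ε) * |s - t| ≤ w s) : |p| ≤ K := by
  refine le_of_forall_pos_le_add fun ε hε => ?_
  obtain ⟨δ, hδ, h1, h2⟩ := exists_pos_of_eventually
    ((hp (ε / 2) (half_pos hε)).and (h (ε / 2) (half_pos hε)))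
  have e1 : t + δ - t = δ := by ring
  have e2 : t - δ - t = -δ := by ring
  rw [e1, abs_of_pos hδ] at h1
  rw [e2, abs_neg, abs_of_pos hδ] at h2
  rw [abs_le]
  constructor
  · nlinarith [h1.1, h1.2]
  · nlinarith [h2.1, h2.2]

lemma notMem_subdiff_of_le {w : ℝ → ℝ} {t K : ℝ} (hK : 0 < K)
    (h : ∀ᶠ s in 𝓝 t, w s ≤ w t - K * |s - t|) (p : ℝ) : p ∉ subdiff w t := by
  intro hp
  obtain ⟨δ, hδ, h1, h2⟩ := exists_pos_of_eventually ((hp (K / 2) (half_pos hK)).and h)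
  have e1 : t + δ - t = δ := by ring
  have e2 : t - δ - t = -δ := by ring
  rw [e1, abs_of_pos hδ] at h1
  rw [e2, abs_neg, abs_of_pos hδ] at h2
  have := mul_pos hK hδ
  linarith [h1.1, h1.2, h2.1, h2.2]

lemma eventually_abs_sub_le_of_hasDerivAt {w : ℝ → ℝ} {t d : ℝ} (h : HasDerivAt w d t) {ε : ℝ}
    (hε : 0 < ε) : ∀ᶠ s in 𝓝 t, |w s - w t - (s - t) * d| ≤ ε * |s - t| := by
  have := (hasDerivAt_iff_isLittleO.1 h).def hε
  simpa [smul_eq_mul] using this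

lemma eq_of_mem_subdiff_of_hasDerivAt {w : ℝ → ℝ} {t d p : ℝ} (h : HasDerivAt w d t)
    (hp : p ∈ subdiff w t) : p = d := by
  have key : |p - d| ≤ 0 := by
    refine le_of_forall_pos_le_add fun ε hε => ?_
    obtain ⟨δ, hδ, h1, h2⟩ := exists_pos_of_eventually
      ((hp (ε / 2) (half_pos hε)).and (eventually_abs_sub_le_of_hasDerivAt h (half_pos hε)))
    have e1 : t + δ - t = δ := by ring
    have e2 : t - δ - t = -δ := by ring
    rw [e1, abs_of_pos hδ, abs_le] at h1
    rw [e2, abs_neg, abs_of_pos hδ, abs_le] at h2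
    rw [abs_le]
    constructor
    · nlinarith [h2.1, h2.2.1, h2.2.2]
    · nlinarith [h1.1, h1.2.1, h1.2.2]
  exact sub_eq_zero.1 (abs_nonpos_iff.1 key)

lemma hasDerivAt_integral_comp (hf : Continuous f) {ξ : ℝ → Gasket a} (hξ : LipschitzWith 1 ξ)
    (s t : ℝ) : HasDerivAt (fun r => ∫ q in s..r, f (ξ q)) (f (ξ t)) t :=
  intervalIntegral.integral_hasDerivAt_right (intervalIntegrable_comp hf hξ s t)
    ((hf.comp hξ.continuous).stronglyMeasurableAtFilter _ _) (hf.comp hξ.continuous).continuousAt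

lemma isMetricSubsolution_value (ha : ∀ i j, i ≠ j → dist (a i) (a j) = 1) (hf : Continuous f)
    (h0 : ∀ x, 0 ≤ f x) : IsMetricSubsolution a f (value a f g) := by
  refine ⟨fun I ξ hI h => (continuousOn_value_comp ha hf h0 hI h).upperSemicontinuousOn, ?_⟩
  intro I ξ hIo hI h0I h p hp
  obtain ⟨r, hr, hball⟩ := Metric.isOpen_iff.1 hIo 0 h0I
  have hIr : ∀ s : ℝ, |s| < r → s ∈ I := fun s hs => hball (by simpa [Real.dist_eq] using hs)
  have hr2 : |r / 2| < r := by rw [abs_of_pos (half_pos hr)]; linarith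
  obtain ⟨η, hη, heq⟩ := h.exists_lipschitzWith ha hI (hIr (-(r / 2)) (by rwa [abs_neg]))
    (hIr (r / 2) hr2) (by linarith)
  have heq0 : η 0 = ξ 0 := heq 0 ⟨by linarith, by linarith⟩
  refine abs_le_of_mem_superdiff hp fun ε hε => ?_
  have hd := eventually_abs_sub_le_of_hasDerivAt (hasDerivAt_integral_comp hf hη 0 0) hε
  filter_upwards [hd, Icc_mem_nhds (show -(r / 2) < 0 by linarith) (half_pos hr)] with s hs hsI
  rw [heq0] at hs
  rw [← heq s hsI, ← heq0]
  simp only [intervalIntegral.integral_same, sub_zero, ← heq0] at hs ⊢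
  rw [abs_le] at hs
  rcases le_total 0 s with h0s | hs0
  · have := value_le_integral_add (g := g) ha hf h0 hη h0s
    rw [abs_of_nonneg h0s] at hs ⊢
    linarith [hs.1, hs.2]
  · have := value_le_integral_add' (g := g) ha hf h0 hη hs0
    rw [intervalIntegral.integral_symm] at this
    rw [abs_of_nonpos hs0] at hs ⊢
    linarith [hs.1, hs.2]

/-- A near-optimal curve from `x`, run forward for positive times and retraced for negative times,
bears the function `w` that witnesses the supersolution property: `w` decreases along the curve at
the rate `f`, and it has a concave kink at time `0`, where its subdifferential is empty. -/
lemma isMetricSupersolution_value (ha : ∀ i j, i ≠ j → dist (a i) (a j) = 1) (hf : Continuous f)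
    {c : ℝ} (hc : 0 < c) (hcf : ∀ x, c ≤ f x) : IsMetricSupersolution a f (value a f g) := by
  have h0 : ∀ x, 0 ≤ f x := fun x => hc.le.trans (hcf x)
  refine ⟨fun I ξ hI h => (continuousOn_value_comp ha hf h0 hI h).lowerSemicontinuousOn, ?_⟩
  intro x hx ε hε
  obtain ⟨-, ⟨ξ, T, y, hξ, hT, rfl, hy, rfl⟩, hlt⟩ :=
    exists_lt_of_csInf_lt (costs_nonempty (f := f) (g := g) ha x)
      (show value a f g x < value a f g x + ε by linarith)
  set ζ : ℝ → Gasket a := fun t => ξ |t| with hζdef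
  have hζ : LipschitzWith 1 ζ := lipschitzWith_one_comp hξ <|
    lipschitzWith_one_iff.2 fun s t => by rw [Real.dist_eq]; exact abs_abs_sub_abs_le s t
  set S : Set ℝ := {t | 0 ≤ t ∧ ζ t ∈ bdry a} with hSdef
  have hScl : IsClosed S := isClosed_Ici.inter (bdry_finite.isClosed.preimage hζ.continuous)
  have hTS : T ∈ S := ⟨hT, by simp [hζdef, abs_of_nonneg hT, hy]⟩
  have hSb : BddBelow S := ⟨0, fun t ht => ht.1⟩
  have hleast : IsLeast S (sInf S) := ⟨hScl.csInf_mem ⟨T, hTS⟩ hSb, fun t ht => csInf_le hSb ht⟩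
  have hgreatest : IsGreatest {t | t ≤ 0 ∧ ζ t ∈ bdry a} (-sInf S) := by
    refine ⟨⟨neg_nonpos.2 hleast.1.1, by simpa [hζdef] using hleast.1.2⟩, fun t ht => ?_⟩
    have : -t ∈ S := ⟨neg_nonneg.2 ht.1, by simpa [hζdef] using ht.2⟩
    linarith [hleast.2 this]
  have hprim : ∀ t, HasDerivAt (fun r => ∫ q in (0 : ℝ)..r, f (ξ q)) (f (ξ t)) t :=
    hasDerivAt_integral_comp hf hξ 0
  have hcont : Continuous fun r => ∫ q in (0 : ℝ)..r, f (ξ q) :=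
    continuous_iff_continuousAt.2 fun t => (hprim t).continuousAt
  refine ⟨ζ, fun t => value a f g (ξ 0) - ∫ q in (0 : ℝ)..|t|, f (ξ q), -sInf S, sInf S,
    isAdmissible_of_lipschitzWith ha hζ fun _ _ => mem_univ _, by simp [hζdef],
    (continuous_const.sub (hcont.comp continuous_abs)).lowerSemicontinuous, hgreatest.isLUB,
    hleast.isGLB, by simp, fun t ht => ?_, fun t ht p hp => ?_⟩
  · have htT : |t| ≤ T := (abs_lt.2 ht).le.trans (hleast.2 hTS)
    have h1 := value_le_integral_add (g := g) ha hf h0 hξ htT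
    rw [hy, ← sub_nonneg] at h1
    have h2 := value_le (g := g) h0 (lipschitzWith_one_add_right hξ T) le_rfl (y := y)
      (by simpa using hy)
    simp only [zero_add, hy, intervalIntegral.integral_same] at h2
    rw [← intervalIntegral.integral_add_adjacent_intervals (intervalIntegrable_comp hf hξ 0 |t|)
      (intervalIntegrable_comp hf hξ |t| T)] at hlt
    simp only [hζdef]
    linarith
  · rcases lt_trichotomy t 0 with htn | rfl | htp
    · have hd : HasDerivAt (fun t => value a f g (ξ 0) - ∫ q in (0 : ℝ)..|t|, f (ξ q))
          (f (ξ (-t))) t := by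
        have h1 := ((hprim (-t)).comp t (hasDerivAt_neg t)).const_sub (value a f g (ξ 0))
        have h2 : HasDerivAt (fun t => value a f g (ξ 0) - ∫ q in (0 : ℝ)..(-t), f (ξ q))
          (f (ξ (-t))) t := by simpa [Function.comp_def] using h1
        refine h2.congr_of_eventuallyEq ?_
        filter_upwards [Iio_mem_nhds htn] with s hs
        rw [abs_of_neg hs]
      rw [eq_of_mem_subdiff_of_hasDerivAt hd hp, abs_of_nonneg (h0 _)]
      simp only [hζdef, abs_of_neg htn]
      linarith
    · refine absurd hp (notMem_subdiff_of_le hc (Eventually.of_forall fun s => ?_) p)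
      have := mul_sub_le_integral hf hcf hξ (abs_nonneg s)
      simp only [abs_zero, intervalIntegral.integral_same, sub_zero] at this ⊢
      linarith
    · have hd : HasDerivAt (fun t => value a f g (ξ 0) - ∫ q in (0 : ℝ)..|t|, f (ξ q))
          (-f (ξ t)) t := by
        refine ((hprim t).const_sub (value a f g (ξ 0))).congr_of_eventuallyEq ?_
        filter_upwards [Ioi_mem_nhds htp] with s hs
        rw [abs_of_pos hs]
      rw [eq_of_mem_subdiff_of_hasDerivAt hd hp, abs_neg, abs_of_nonneg (h0 _)]
      simp only [hζdef, abs_of_pos htp]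
      linarith

lemma isMetricSolution_value (ha : ∀ i j, i ≠ j → dist (a i) (a j) = 1) (hf : Continuous f)
    {c : ℝ} (hc : 0 < c) (hcf : ∀ x, c ≤ f x) (hS : CompatGasket a f g) :
    IsMetricSolution a f g (value a f g) := by
  have h0 : ∀ x, 0 ≤ f x := fun x => hc.le.trans (hcf x)
  exact ⟨isMetricSubsolution_value ha hf h0, isMetricSupersolution_value ha hf hc hcf,
    fun I ξ hI h => (continuousOn_value_comp ha hf h0 hI h).upperSemicontinuousOn,
    fun I ξ hI h => (continuousOn_value_comp ha hf h0 hI h).lowerSemicontinuousOn,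
    value_bdry ha h0 hS⟩

/-! ### Comparison on an interval -/

lemma mem_superdiff_of_hasDerivAt {w ψ : ℝ → ℝ} {t d : ℝ} (h : HasDerivAt ψ d t)
    (hle : ∀ᶠ s in 𝓝 t, w s ≤ ψ s) (ht : w t = ψ t) : d ∈ superdiff w t := by
  intro ε hε
  filter_upwards [eventually_abs_sub_le_of_hasDerivAt h hε, hle] with s h1 h2
  linarith [(abs_le.1 h1).2]

lemma mem_subdiff_of_hasDerivAt {w ψ : ℝ → ℝ} {t d : ℝ} (h : HasDerivAt ψ d t)
    (hle : ∀ᶠ s in 𝓝 t, ψ s ≤ w s) (ht : w t = ψ t) : d ∈ subdiff w t := by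
  intro ε hε
  filter_upwards [eventually_abs_sub_le_of_hasDerivAt h hε, hle] with s h1 h2
  linarith [(abs_le.1 h1).1]

lemma hasDerivAt_integral_of_continuous {F : ℝ → ℝ} (hF : Continuous F) (s t : ℝ) :
    HasDerivAt (fun r => ∫ q in s..r, F q) (F t) t :=
  intervalIntegral.integral_hasDerivAt_right (hF.intervalIntegrable s t)
    (hF.stronglyMeasurableAtFilter _ _) hF.continuousAt

/-- A viscosity subsolution of `|W'| ≤ F` on an interval decreases by at most the integral of
`F`. -/
lemma le_integral_add_of_superdiff {W F : ℝ → ℝ} (hW : Continuous W) (hF : Continuous F) {s t : ℝ}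
    (hst : s < t) (h : ∀ r ∈ Ioo s t, ∀ p ∈ superdiff W r, |p| ≤ F r) :
    W s ≤ (∫ r in s..t, F r) + W t := by
  by_contra! hlt
  have hprim := hasDerivAt_integral_of_continuous hF s
  set G : ℝ → ℝ := fun r => W r + ∫ q in s..r, F q with hG
  have hGc : Continuous G :=
    hW.add (continuous_iff_continuousAt.2 fun r => (hprim r).continuousAt)
  have hGst : G t < G s := by
    simp only [hG, intervalIntegral.integral_same]
    linarith
  -- this function vanishes at both endpoints and is positive somewhere in between; an interior
  -- maximum of it means that `G` is touched from above by `r ↦ G t + K / (r - s)`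
  obtain ⟨r, hr, hmax⟩ := isCompact_Icc.exists_isMaxOn (nonempty_Icc.2 hst.le)
    (f := fun r => (G r - G t) * (r - s))
    ((hGc.sub continuous_const).mul (continuous_id.sub continuous_const)).continuousOn
  obtain ⟨m, hm1, hm2, hm3⟩ : ∃ m, G t < G m ∧ s < m ∧ m < t := by
    have h1 : ∀ᶠ m in 𝓝[>] s, G t < G m :=
      (hGc.continuousAt.eventually (lt_mem_nhds hGst)).filter_mono nhdsWithin_le_nhds
    obtain ⟨m, h1, h2⟩ := (h1.and (Ioo_mem_nhdsGT hst)).exists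
    exact ⟨m, h1, h2.1, h2.2⟩
  set K := (G r - G t) * (r - s) with hK
  have hKpos : 0 < K :=
    (mul_pos (sub_pos.2 hm1) (sub_pos.2 hm2)).trans_le (hmax ⟨hm2.le, hm3.le⟩)
  have hrs : s < r := by
    refine hr.1.lt_of_ne ?_
    rintro rfl
    simp [hK] at hKpos
  have hrt : r < t := by
    refine hr.2.lt_of_ne ?_
    rintro rfl
    simp [hK] at hKpos
  have hne : r - s ≠ 0 := (sub_pos.2 hrs).ne'
  have hd : HasDerivAt (fun q => G t + K * (q - s)⁻¹ - ∫ x in s..q, F x)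
      (K * (-1 / (r - s) ^ 2) - F r) r :=
    ((((hasDerivAt_id r).sub_const s).inv hne).const_mul K |>.const_add (G t)).sub (hprim r)
  have hmem := mem_superdiff_of_hasDerivAt (w := W) hd ?_ ?_
  · have h1 := (abs_le.1 (h r ⟨hrs, hrt⟩ _ hmem)).1
    have h2 : K * (-1 / (r - s) ^ 2) < 0 :=
      mul_neg_of_pos_of_neg hKpos (div_neg_of_neg_of_pos (by norm_num) (by positivity))
    linarith
  · filter_upwards [Ioo_mem_nhds hrs hrt] with q hq
    have h1 : (G q - G t) * (q - s) ≤ K := hmax ⟨hq.1.le, hq.2.le⟩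
    have h2 : G q - G t ≤ K * (q - s)⁻¹ := by
      rw [← div_eq_mul_inv, le_div_iff₀ (sub_pos.2 hq.1)]
      exact h1
    have h3 : G q = W q + ∫ x in s..q, F x := rfl
    linarith
  · have h1 : K * (r - s)⁻¹ = G r - G t := by
      rw [hK, mul_assoc, mul_inv_cancel₀ hne, mul_one]
    have h3 : G r = W r + ∫ x in s..r, F x := rfl
    linarith

/-- A viscosity supersolution of `|w'| ≥ F > 0` on an interval around `0` lies at `0` above the
smaller of the two values that the endpoints propagate. With `H` the primitive of `F` that vanishes
at `0`, the test functions `B - √(δ² + H²)` are smooth versions of the concave solution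
`B - |H|`. -/
lemma min_le_of_subdiff {w F : ℝ → ℝ} (hw : LowerSemicontinuous w) (hF : Continuous F)
    (hFpos : ∀ r, 0 < F r) {s t : ℝ} (hs : s < 0) (ht : 0 < t)
    (h : ∀ r ∈ Ioo s t, ∀ p ∈ subdiff w r, F r ≤ |p|) :
    min (w t + ∫ r in (0 : ℝ)..t, F r) (w s + ∫ r in s..0, F r) ≤ w 0 := by
  by_contra! hlt
  have hprim := hasDerivAt_integral_of_continuous hF 0
  set H : ℝ → ℝ := fun r => ∫ q in (0 : ℝ)..r, F q with hH
  have hHs : ∫ r in s..0, F r = -H s := intervalIntegral.integral_symm _ _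
  rw [hHs] at hlt
  set B := min (w t + H t) (w s + -H s) with hB
  set δ := (B - w 0) / 2 with hδ
  have hδpos : 0 < δ := half_pos (sub_pos.2 hlt)
  have hsqpos : ∀ r, 0 < δ ^ 2 + H r ^ 2 := fun r => by positivity
  set φ : ℝ → ℝ := fun r => B - √(δ ^ 2 + H r ^ 2) with hφ
  have hd : ∀ r, HasDerivAt φ (-(H r * F r / √(δ ^ 2 + H r ^ 2))) r := by
    intro r
    have := ((((hprim r).pow 2).const_add (δ ^ 2)).sqrt (hsqpos r).ne').const_sub B
    refine this.congr_deriv ?_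
    have : √(δ ^ 2 + H r ^ 2) ≠ 0 := (Real.sqrt_pos.2 (hsqpos r)).ne'
    simp
    field_simp
  have hφc : Continuous φ := continuous_iff_continuousAt.2 fun r => (hd r).continuousAt
  have hlsc : LowerSemicontinuous fun r => w r + -φ r := hw.add hφc.neg.lowerSemicontinuous
  obtain ⟨r, hr, hmin⟩ := (hlsc.lowerSemicontinuousOn (Icc s t)).exists_isMinOn
    (nonempty_Icc.2 (hs.trans ht).le) isCompact_Icc
  have hH0 : H 0 = 0 := intervalIntegral.integral_same
  have hneg : w r + -φ r < 0 := by
    refine (hmin (⟨hs.le, ht.le⟩ : (0 : ℝ) ∈ Icc s t)).trans_lt ?_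
    simp only [hφ, hH0]
    rw [show δ ^ 2 + 0 ^ 2 = δ ^ 2 by ring, Real.sqrt_sq hδpos.le]
    linarith
  have habs : ∀ r, |H r| < √(δ ^ 2 + H r ^ 2) := by
    intro r
    rw [← Real.sqrt_sq_eq_abs]
    exact Real.sqrt_lt_sqrt (sq_nonneg _) (by nlinarith)
  have hrt : r < t := by
    refine hr.2.lt_of_ne ?_
    rintro rfl
    have h1 : B ≤ w r + H r := min_le_left _ _
    have h2 := (le_abs_self _).trans_lt (habs r)
    simp only [hφ] at hneg
    linarith
  have hrs : s < r := by
    refine hr.1.lt_of_ne ?_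
    rintro rfl
    have h1 : B ≤ w s + -H s := min_le_right _ _
    have h2 := (neg_le_abs _).trans_lt (habs s)
    simp only [hφ] at hneg
    linarith
  have hmem := mem_subdiff_of_hasDerivAt (w := w) ((hd r).add_const (w r + -φ r))
    (by
      filter_upwards [Ioo_mem_nhds hrs hrt] with q hq
      have : w r + -φ r ≤ w q + -φ q := hmin ⟨hq.1.le, hq.2.le⟩
      linarith) (by ring)
  refine absurd (h r ⟨hrs, hrt⟩ _ hmem) (not_le.2 ?_)
  have hsq : 0 < √(δ ^ 2 + H r ^ 2) := Real.sqrt_pos.2 (hsqpos r)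
  rw [abs_neg, abs_div, abs_mul, abs_of_pos (hFpos r), abs_of_pos hsq, div_lt_iff₀ hsq, mul_comm]
  exact mul_lt_mul_of_pos_left (habs r) (hFpos r)

/-! ### Uniqueness of the metric viscosity solution -/

lemma IsMetricSolution.continuous_comp (ha : ∀ i j, i ≠ j → dist (a i) (a j) = 1)
    {u : Gasket a → ℝ} (hu : IsMetricSolution a f g u) {ξ : ℝ → Gasket a}
    (hξ : LipschitzWith 1 ξ) : Continuous fun t => u (ξ t) := by
  have hadm : IsAdmissible a univ univ ξ :=
    isAdmissible_of_lipschitzWith ha hξ fun _ _ => mem_univ _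
  rw [← continuousOn_univ, continuousOn_iff_lower_upperSemicontinuousOn]
  exact ⟨hu.2.2.2.1 univ ξ ordConnected_univ hadm, hu.2.2.1 univ ξ ordConnected_univ hadm⟩

lemma superdiff_comp_add {w : ℝ → ℝ} {t p : ℝ} (hp : p ∈ superdiff w t) :
    p ∈ superdiff (fun r => w (r + t)) 0 := by
  intro ε hε
  have h : Tendsto (fun r : ℝ => r + t) (𝓝 0) (𝓝 t) := by
    simpa using (continuous_add_const t).tendsto (0 : ℝ)
  filter_upwards [h.eventually (hp ε hε)] with s hs
  simpa using hs

lemma IsMetricSolution.le_value (ha : ∀ i j, i ≠ j → dist (a i) (a j) = 1) (hf : Continuous f)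
    (h0 : ∀ x, 0 ≤ f x) (hS : CompatGasket a f g) {u : Gasket a → ℝ}
    (hu : IsMetricSolution a f g u) (x : Gasket a) : u x ≤ value a f g x := by
  have hbd : ∀ y ∈ bdry a, u y = value a f g y := fun y hy => by
    rw [hu.2.2.2.2 ⟨y, hy⟩, value_bdry ha h0 hS ⟨y, hy⟩]
  by_cases hx : x ∈ bdry a
  · exact (hbd x hx).le
  refine SierpinskiEikonal.le_value ha ?_
  rintro ξ T y hξ hT rfl hy
  -- the first time at which the curve hits the boundary
  set S : Set ℝ := {t | 0 ≤ t ∧ ξ t ∈ bdry a} with hSdef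
  have hScl : IsClosed S := isClosed_Ici.inter (bdry_finite.isClosed.preimage hξ.continuous)
  have hTS : T ∈ S := ⟨hT, by simp [hy]⟩
  have hSb : BddBelow S := ⟨0, fun t ht => ht.1⟩
  have hτ : sInf S ∈ S := hScl.csInf_mem ⟨T, hTS⟩ hSb
  have hτT : sInf S ≤ T := csInf_le hSb hTS
  have hτpos : 0 < sInf S := by
    refine hτ.1.lt_of_ne fun h => hx ?_
    rw [h]
    exact hτ.2
  have h1 := le_integral_add_of_superdiff (hu.continuous_comp ha hξ) (hf.comp hξ.continuous) hτpos
    (fun t ht p hp => by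
      have h := hu.1.2 (Ioo (-t) (sInf S - t)) (fun r => ξ (r + t)) isOpen_Ioo ordConnected_Ioo
        ⟨neg_lt_zero.2 ht.1, sub_pos.2 ht.2⟩
        (isAdmissible_of_lipschitzWith ha (lipschitzWith_one_add_right hξ t) fun r hr hb => ?_) p
        (superdiff_comp_add hp)
      · simpa using h
      · have : r + t ∈ S := ⟨by linarith [hr.1], hb⟩
        linarith [csInf_le hSb this, hr.2])
  have h2 := value_le_integral_add (g := g) ha hf h0 hξ hτT
  rw [hbd _ hτ.2] at h1
  rw [hy, value_bdry ha h0 hS] at h2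
  rw [← intervalIntegral.integral_add_adjacent_intervals (intervalIntegrable_comp hf hξ 0 (sInf S))
    (intervalIntegrable_comp hf hξ _ T)]
  simp only [Function.comp_apply] at h1
  linarith

/-- The final estimate for the comparison with a supersolution: `J` is the cost of a nearly complete
curve to the boundary and `K` its cost for the reduced slowness `f - ε`. -/
lemma sub_le_of_cost_estimates {c ε v u m y w J K : ℝ} (hc : 0 < c) (hε : 0 < ε)
    (hv : v ≤ J + ε + y) (hm : m ≤ y) (hK : (1 - ε / c) * J ≤ K) (hw : y - 2 * ε ≤ w)
    (hu : w + K ≤ u) (hεc : ε < c) :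
    v - u ≤ ε * (3 + (v - m) / c) := by
  have h1 : 0 < ε / c := div_pos hε hc
  have h2 : ε / c < 1 := (div_lt_one hc).2 hεc
  have h3 : ε * (3 + (v - m) / c) = 3 * ε + ε / c * (v - m) := by ring
  have h4 : (1 - ε / c) * (v - ε - y) ≤ (1 - ε / c) * J :=
    mul_le_mul_of_nonneg_left (by linarith) (by linarith)
  have h5 : ε / c * m ≤ ε / c * y := mul_le_mul_of_nonneg_left hm h1.le
  have h6 : 0 < ε / c * ε := mul_pos h1 hε
  rw [h3]
  linarith

lemma IsMetricSolution.value_le (ha : ∀ i j, i ≠ j → dist (a i) (a j) = 1) (hf : Continuous f)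
    {c : ℝ} (hc : 0 < c) (hcf : ∀ x, c ≤ f x) (hS : CompatGasket a f g) {u : Gasket a → ℝ}
    (hu : IsMetricSolution a f g u) (x : Gasket a) : value a f g x ≤ u x := by
  have h0 : ∀ x, 0 ≤ f x := fun x => hc.le.trans (hcf x)
  by_cases hx : x ∈ bdry a
  · rw [hu.2.2.2.2 ⟨x, hx⟩, value_bdry ha h0 hS ⟨x, hx⟩]
  set m := ⨅ y, g y with hm
  have key : ∀ ε, 0 < ε → ε < c →
      value a f g x - u x ≤ ε * (3 + (value a f g x - m) / c) := by
    intro ε hε hεc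
    obtain ⟨ξ, w, Tm, Tp, hadm, rfl, hw, hTm, hTp, hw0, hwu, hsub⟩ := hu.2.1.2 x hx ε hε
    have hξ : LipschitzWith 1 ξ := lipschitzWith_one_of_le fun s t hst =>
      hadm.dist_le ha ordConnected_univ (mem_univ s) (mem_univ t) hst
    have hclp : IsClosed (ξ ⁻¹' bdry a) := bdry_finite.isClosed.preimage hξ.continuous
    have hTp' : 0 ≤ Tp ∧ ξ Tp ∈ bdry a := hTp.mem_of_isClosed hTp.nonempty (isClosed_Ici.inter hclp)
    have hTm' : Tm ≤ 0 ∧ ξ Tm ∈ bdry a := hTm.mem_of_isClosed hTm.nonempty (isClosed_Iic.inter hclp)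
    have hTp0 : 0 < Tp := hTp'.1.lt_of_ne fun h => hx (by rw [h]; exact hTp'.2)
    have hTm0 : Tm < 0 := hTm'.1.lt_of_ne fun h => hx (by rw [← h]; exact hTm'.2)
    have huc := hu.continuous_comp ha hξ
    have hFc : Continuous fun r => f (ξ r) - ε := (hf.comp hξ.continuous).sub continuous_const
    -- times close to the exit and entrance times
    have hnear : ∀ T, ∀ᶠ t in 𝓝 T, u (ξ T) - ε < u (ξ t) ∧ |∫ r in T..t, f (ξ r)| < ε := by
      intro T
      have h1 : ∀ᶠ t in 𝓝 T, u (ξ T) - ε < u (ξ t) :=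
        huc.continuousAt.eventually (lt_mem_nhds (by linarith))
      have h2 : Tendsto (fun t => |∫ r in T..t, f (ξ r)|) (𝓝 T) (𝓝 0) := by
        simpa using ((hasDerivAt_integral_comp hf hξ T T).continuousAt.abs).tendsto
      exact h1.and (h2.eventually (gt_mem_nhds hε))
    obtain ⟨t, ⟨ht1, ht2⟩, ht⟩ :=
      (((hnear Tp).filter_mono nhdsWithin_le_nhds).and (Ioo_mem_nhdsLT hTp0)).exists
    obtain ⟨s, ⟨hs1, hs2⟩, hs⟩ :=
      (((hnear Tm).filter_mono nhdsWithin_le_nhds).and (Ioo_mem_nhdsGT hTm0)).exists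
    have hmin := min_le_of_subdiff hw hFc (fun r => by linarith [hcf (ξ r)]) hs.2 ht.1
      (fun r hr p hp => hsub r ⟨hs.1.trans hr.1, hr.2.trans ht.2⟩ p hp)
    have hred : ∀ p q, p ≤ q → (1 - ε / c) * ∫ r in p..q, f (ξ r) ≤ ∫ r in p..q, (f (ξ r) - ε) := by
      intro p q hpq
      rw [← intervalIntegral.integral_const_mul]
      refine intervalIntegral.integral_mono_on hpq
        ((intervalIntegrable_comp hf hξ p q).const_mul _) (hFc.intervalIntegrable p q) fun r _ => ?_
      have h1 : ε / c * c ≤ ε / c * f (ξ r) := mul_le_mul_of_nonneg_left (hcf _) (by positivity)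
      rw [div_mul_cancel₀ _ hc.ne'] at h1
      linarith
    rw [hw0] at hmin
    have hut : u (ξ t) - ε ≤ w t := hwu t ⟨hTm0.trans ht.1, ht.2⟩
    have hus : u (ξ s) - ε ≤ w s := hwu s ⟨hs.1, hs.2.trans hTp0⟩
    rcases min_le_iff.1 hmin with h | h
    · have h1 := value_le_integral_add (g := g) ha hf h0 hξ hTp0.le
      rw [← intervalIntegral.integral_add_adjacent_intervals (intervalIntegrable_comp hf hξ 0 t)
        (intervalIntegrable_comp hf hξ t Tp), value_bdry ha h0 hS ⟨_, hTp'.2⟩] at h1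
      have h2 : u (ξ Tp) = g ⟨_, hTp'.2⟩ := hu.2.2.2.2 ⟨_, hTp'.2⟩
      rw [intervalIntegral.integral_symm, abs_neg] at ht2
      have h3 := (le_abs_self _).trans_lt ht2
      exact sub_le_of_cost_estimates hc hε (y := g ⟨_, hTp'.2⟩) (by linarith) (iInf_bdry_le g _)
        (hred 0 t ht.1.le) (by linarith) h hεc
    · have h1 := value_le_integral_add' (g := g) ha hf h0 hξ hTm0.le
      rw [← intervalIntegral.integral_add_adjacent_intervals (intervalIntegrable_comp hf hξ Tm s)
        (intervalIntegrable_comp hf hξ s 0), value_bdry ha h0 hS ⟨_, hTm'.2⟩] at h1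
      have h2 : u (ξ Tm) = g ⟨_, hTm'.2⟩ := hu.2.2.2.2 ⟨_, hTm'.2⟩
      have h3 := (le_abs_self _).trans_lt hs2
      exact sub_le_of_cost_estimates hc hε (y := g ⟨_, hTm'.2⟩) (by linarith) (iInf_bdry_le g _)
        (hred s 0 hs.2.le) (by linarith) h hεc
  by_contra! hlt
  set D := value a f g x - u x with hD
  have hDpos : 0 < D := sub_pos.2 hlt
  set L := 3 + (value a f g x - m) / c with hL
  have hLpos : 0 < L := by
    have := div_nonneg (sub_nonneg.2 (iInf_le_value (g := g) ha h0 x)) hc.le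
    rw [hL]
    linarith
  have hε : 0 < min (c / 2) (D / (2 * L)) := by positivity
  have h1 := key _ hε ((min_le_left _ _).trans_lt (half_lt_self hc))
  have h2 := mul_le_mul_of_nonneg_right (min_le_right (c / 2) (D / (2 * L))) hLpos.le
  have h3 : D / (2 * L) * L = D / 2 := by field_simp
  linarith

lemma IsMetricSolution.eq_value (ha : ∀ i j, i ≠ j → dist (a i) (a j) = 1) (hf : Continuous f)
    {c : ℝ} (hc : 0 < c) (hcf : ∀ x, c ≤ f x) (hS : CompatGasket a f g) {u : Gasket a → ℝ}
    (hu : IsMetricSolution a f g u) : u = value a f g :=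
  funext fun x => le_antisymm (hu.le_value ha hf (fun x => hc.le.trans (hcf x)) hS x)
    (hu.value_le ha hf hc hcf hS x)

variable {n : ℕ}

/-! ### The graph eikonal equation -/

lemma neg_one_div_mesh_mul_le_iff (n : ℕ) (p q r : ℝ) :
    -(1 / mesh n) * (p - q) ≤ r ↔ q ≤ mesh n * r + p := by
  have h := mesh_pos n
  rw [show -(1 / mesh n) * (p - q) = (q - p) / mesh n by ring, div_le_iff₀ h]
  constructor <;> intro <;> linarith

lemma discreteGrad_eq_iff (v : vertices a n → ℝ) (x : vertices a n) (r : ℝ) :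
    discreteGrad a n v x = r ↔
      (∀ y : vertices a n, Adj a n (y.1 : Plane) x.1 → v x ≤ mesh n * r + v y) ∧
      ∃ y : vertices a n, Adj a n (y.1 : Plane) x.1 ∧ mesh n * r + v y ≤ v x := by
  have hne : Nonempty {y : vertices a n // Adj a n (y.1 : Plane) (x.1 : Plane)} := by
    obtain ⟨y, hy⟩ := exists_adj n x
    exact ⟨⟨y, hy⟩⟩
  have hpos := mesh_pos n
  have hge : ∀ p q : ℝ, r ≤ -(1 / mesh n) * (p - q) ↔ mesh n * r + p ≤ q := by
    intro p q
    rw [show -(1 / mesh n) * (p - q) = (q - p) / mesh n by ring, le_div_iff₀ hpos]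
    constructor <;> intro <;> linarith
  have hbdd := (finite_range fun y : {y : vertices a n // Adj a n (y.1 : Plane) (x.1 : Plane)} =>
    -(1 / mesh n) * (v y.1 - v x)).bddAbove
  constructor
  · intro h
    refine ⟨fun y hy => ?_, ?_⟩
    · rw [← neg_one_div_mesh_mul_le_iff, ← h]
      exact le_ciSup hbdd ⟨y, hy⟩
    · obtain ⟨y, hy⟩ := exists_eq_ciSup_of_finite
        (f := fun y : {y : vertices a n // Adj a n (y.1 : Plane) (x.1 : Plane)} =>
          -(1 / mesh n) * (v y.1 - v x))
      refine ⟨y.1, y.2, ?_⟩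
      rw [← hge]
      exact (h.symm.trans hy.symm).le
  · rintro ⟨h1, y, hy, h2⟩
    refine le_antisymm (ciSup_le fun z => ?_) (((hge _ _).2 h2).trans (le_ciSup hbdd ⟨y, hy⟩))
    rw [neg_one_div_mesh_mul_le_iff]
    exact h1 z.1 z.2

/-- Subsolutions of the graph eikonal equation, with the boundary condition. -/
def IsDiscreteSubsolution (a : Fin 3 → Plane) (n : ℕ) (f : Gasket a → ℝ) (g : bdry a → ℝ)
    (v : vertices a n → ℝ) : Prop :=
  (∀ x : vertices a n, x.1 ∉ bdry a → ∀ y : vertices a n, Adj a n (y.1 : Plane) x.1 →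
    v x ≤ mesh n * f x.1 + v y) ∧
  ∀ (x : vertices a n) (hx : x.1 ∈ bdry a), v x = g ⟨x.1, hx⟩

lemma isDiscreteSolution_iff (v : vertices a n → ℝ) :
    IsDiscreteSolution a n f g v ↔ IsDiscreteSubsolution a n f g v ∧
      ∀ x : vertices a n, x.1 ∉ bdry a →
        ∃ y : vertices a n, Adj a n (y.1 : Plane) x.1 ∧ mesh n * f x.1 + v y ≤ v x := by
  simp only [IsDiscreteSolution, IsDiscreteSubsolution, discreteGrad_eq_iff]
  constructor
  · rintro ⟨h1, h2⟩
    exact ⟨⟨fun x hx => (h1 x hx).1, h2⟩, fun x hx => (h1 x hx).2⟩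
  · rintro ⟨⟨h1, h2⟩, h3⟩
    exact ⟨fun x hx => ⟨h1 x hx, h3 x hx⟩, h2⟩

/-- Induction along the steepest descent of a discrete solution, which decreases strictly and hence
ends at the boundary. -/
lemma IsDiscreteSolution.induction (h0 : ∀ x, 0 < f x) {v : vertices a n → ℝ}
    (hv : IsDiscreteSolution a n f g v) {P : vertices a n → Prop} (hb : ∀ x, x.1 ∈ bdry a → P x)
    (hi : ∀ x y : vertices a n, x.1 ∉ bdry a → Adj a n (y.1 : Plane) x.1 →
      mesh n * f x.1 + v y ≤ v x → P y → P x) (x : vertices a n) : P x := by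
  have : Std.Irrefl fun x y : vertices a n => v x < v y := ⟨fun x => lt_irrefl _⟩
  have : IsTrans (vertices a n) fun x y => v x < v y := ⟨fun x y z => lt_trans⟩
  have hwf : WellFounded fun x y : vertices a n => v x < v y :=
    Finite.wellFounded_of_trans_of_irrefl _
  induction x using hwf.induction with
  | _ x ih =>
    by_cases hx : x.1 ∈ bdry a
    · exact hb x hx
    obtain ⟨y, hy, hle⟩ := ((isDiscreteSolution_iff v).1 hv).2 x hx
    have := mul_pos (mesh_pos n) (h0 x.1)
    exact hi x y hx hy hle (ih y (by linarith))

lemma IsDiscreteSubsolution.le_of_isDiscreteSolution (h0 : ∀ x, 0 < f x) {v w : vertices a n → ℝ}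
    (hv : IsDiscreteSubsolution a n f g v) (hw : IsDiscreteSolution a n f g w) : v ≤ w := by
  refine hw.induction h0 (P := fun x => v x ≤ w x) (fun x hx => ?_) fun x y hx hy hle ih => ?_
  · rw [hv.2 x hx, hw.2 x hx]
  · linarith [hv.1 x hx y hy]

/-- A curve of speed at most one needs at least the time `mesh n` between consecutive visits to
distinct vertices of level `n`, and these are adjacent. So the cost of a curve controls a discrete
subsolution at its starting point, up to the oscillation factor `K` of `f` at the scale
`mesh n`. -/
lemma IsDiscreteSubsolution.le_cost (ha : ∀ i j, i ≠ j → dist (a i) (a j) = 1) (hf : Continuous f)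
    (h0 : ∀ x, 0 < f x) (hS : CompatGasket a f g) {K : ℝ}
    (hK : ∀ x y, dist x y ≤ mesh n → f x ≤ K * f y) {v : vertices a n → ℝ}
    (hv : IsDiscreteSubsolution a n f g v) (N : ℕ) {ξ : ℝ → Gasket a} (hξ : LipschitzWith 1 ξ)
    {T : ℝ} (hT : 0 ≤ T) (hTN : T ≤ N * mesh n) (y : bdry a) (hy : ξ T = y) (x : vertices a n)
    (hx : ξ 0 = x) : v x ≤ K * (∫ t in (0 : ℝ)..T, f (ξ t)) + g y := by
  have h0' : ∀ x, 0 ≤ f x := fun x => (h0 x).le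
  have hK1 : 1 ≤ K := by
    have h := hK (corner a 0) (corner a 0) (by simpa using (mesh_pos n).le)
    exact le_of_mul_le_mul_right (by simpa using h) (h0 (corner a 0))
  induction N generalizing ξ T x with
  | zero =>
    obtain rfl : T = 0 := le_antisymm (by simpa using hTN) hT
    have hxb : x.1 ∈ bdry a := by rw [← hx, hy]; exact y.2
    rw [hv.2 x hxb]
    have : (⟨x.1, hxb⟩ : bdry a) = y := Subtype.ext (hx.symm.trans hy)
    simp [this]
  | succ N ih =>
    by_cases hxb : x.1 ∈ bdry a
    · rw [hv.2 x hxb]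
      have h1 := hS ⟨x.1, hxb⟩ y T ξ hT
        (isAdmissible_of_lipschitzWith ha hξ fun _ _ => mem_univ _) hx hy
      have h2 := mul_le_mul_of_nonneg_right hK1 (integral_comp_nonneg h0' ξ hT)
      linarith
    -- `τ` is the first visit to another vertex, `σ` the last visit to `x` before that
    set S : Set ℝ := {t | 0 ≤ t ∧ ξ t ∈ vertices a n \ {ξ 0}} with hSdef
    have hScl : IsClosed S := isClosed_Ici.inter
      (((vertices_finite n).subset sdiff_subset).isClosed.preimage hξ.continuous)
    have hTS : T ∈ S := by
      refine ⟨hT, ?_, fun h => hxb ?_⟩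
      · rw [hy]; exact bdry_subset_vertices n y.2
      · rw [← hx, ← mem_singleton_iff.1 h, hy]; exact y.2
    have hSb : BddBelow S := ⟨0, fun t ht => ht.1⟩
    have hτ : sInf S ∈ S := hScl.csInf_mem ⟨T, hTS⟩ hSb
    have hτT : sInf S ≤ T := csInf_le hSb hTS
    have hτmin : ∀ t ∈ S, sInf S ≤ t := fun t ht => csInf_le hSb ht
    set τ := sInf S
    have hcomp : IsCompact (Icc 0 τ ∩ ξ ⁻¹' {ξ 0}) :=
      isCompact_Icc.inter_right (isClosed_singleton.preimage hξ.continuous)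
    obtain ⟨σ, ⟨⟨hσ0, hστ⟩, hσx⟩, hσmax⟩ := hcomp.exists_isGreatest ⟨0, ⟨le_rfl, hτ.1⟩, rfl⟩
    have hσx : ξ σ = ξ 0 := hσx
    have hne : ξ σ ≠ ξ τ := fun h => hτ.2.2 (h.symm.trans hσx)
    have hlt : σ < τ := hστ.lt_of_ne fun h => hne (by rw [h])
    have hadj : Adj a n (ξ σ) (ξ τ) := by
      refine adj_of_passage ha hξ.continuous hlt ?_ hτ.2.1 hne fun r hr hrv => ?_
      · rw [hσx, hx]; exact x.2
      · by_cases h : ξ r = ξ 0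
        · exact absurd (hσmax ⟨⟨hσ0.trans hr.1.le, hr.2.le⟩, h⟩) (not_le.2 hr.1)
        · exact absurd (hτmin r ⟨hσ0.trans hr.1.le, hrv, h⟩) (not_le.2 hr.2)
    have hmesh : mesh n ≤ τ - σ := by
      rw [← hadj.dist_eq ha]
      exact dist_le_sub_of_lipschitzWith hξ hlt.le
    have hpos := mesh_pos n
    have hcost : mesh n * f x.1 ≤ K * ∫ t in (0 : ℝ)..τ, f (ξ t) := by
      have h1 : ∫ t in σ..(σ + mesh n), f (ξ t) ≤ ∫ t in (0 : ℝ)..τ, f (ξ t) :=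
        intervalIntegral.integral_mono_interval hσ0 (by linarith) (by linarith)
          (Eventually.of_forall fun t => h0' _) (intervalIntegrable_comp hf hξ 0 τ)
      have h2 : mesh n * f x.1 ≤ ∫ t in σ..(σ + mesh n), K * f (ξ t) := by
        have := intervalIntegral.integral_mono_on (show σ ≤ σ + mesh n by linarith)
          (intervalIntegrable_const (c := f x.1))
          ((intervalIntegrable_comp hf hξ σ (σ + mesh n)).const_mul K) fun t ht => by
            refine hK _ _ ?_
            rw [← hx, ← hσx]
            exact (dist_le_sub_of_lipschitzWith hξ ht.1).trans (by linarith [ht.2])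
        simpa using this
      rw [intervalIntegral.integral_const_mul] at h2
      exact h2.trans (mul_le_mul_of_nonneg_left h1 (by linarith))
    have hstep : v x ≤ mesh n * f x.1 + v ⟨ξ τ, hτ.2.1⟩ := by
      have h := hadj.symm
      rw [hσx, hx] at h
      exact hv.1 x hxb _ h
    have hrec := ih (lipschitzWith_one_add_right hξ τ) (T := T - τ) (by linarith) (by
      push_cast at hTN
      linarith) (by simpa using hy) ⟨ξ τ, hτ.2.1⟩ (by simp)
    have hshift : ∫ t in (0 : ℝ)..(T - τ), f (ξ (t + τ)) = ∫ t in τ..T, f (ξ t) := by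
      rw [intervalIntegral.integral_comp_add_right (fun r => f (ξ r))]
      simp
    rw [hshift] at hrec
    rw [← intervalIntegral.integral_add_adjacent_intervals (intervalIntegrable_comp hf hξ 0 τ)
      (intervalIntegrable_comp hf hξ τ T), mul_add]
    linarith

lemma IsDiscreteSubsolution.le_value (ha : ∀ i j, i ≠ j → dist (a i) (a j) = 1)
    (hf : Continuous f) (h0 : ∀ x, 0 < f x) (hS : CompatGasket a f g) {K : ℝ} (hK1 : 1 ≤ K)
    (hK : ∀ x y, dist x y ≤ mesh n → f x ≤ K * f y) {v : vertices a n → ℝ}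
    (hv : IsDiscreteSubsolution a n f g v) (x : vertices a n) :
    v x ≤ K * value a f g x - (K - 1) * ⨅ y, g y := by
  have hKpos : 0 < K := by linarith
  have h : (v x + (K - 1) * ⨅ y, g y) / K ≤ value a f g x := by
    refine SierpinskiEikonal.le_value ha fun ξ T y hξ hT hx hy => ?_
    obtain ⟨N, hN⟩ := exists_nat_ge (T / mesh n)
    rw [div_le_iff₀ (mesh_pos n)] at hN
    have h1 := hv.le_cost ha hf h0 hS hK N hξ hT hN y hy x hx
    rw [div_le_iff₀ hKpos]
    have h2 := mul_le_mul_of_nonneg_left (iInf_bdry_le g y) (sub_nonneg.2 hK1)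
    linarith
  rw [div_le_iff₀ hKpos] at h
  linarith

lemma IsDiscreteSolution.value_le (ha : ∀ i j, i ≠ j → dist (a i) (a j) = 1)
    (hf : Continuous f) (h0 : ∀ x, 0 < f x) (hS : CompatGasket a f g) {K : ℝ} (hK1 : 1 ≤ K)
    (hK : ∀ x y, dist x y ≤ mesh n → f x ≤ K * f y) {v : vertices a n → ℝ}
    (hv : IsDiscreteSolution a n f g v) (x : vertices a n) :
    value a f g x ≤ K * v x - (K - 1) * ⨅ y, g y := by
  have h0' : ∀ x, 0 ≤ f x := fun x => (h0 x).le
  refine hv.induction h0 (P := fun x => value a f g x ≤ K * v x - (K - 1) * ⨅ y, g y)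
    (fun x hx => ?_) (fun x y hx hy hle ih => ?_) x
  · have h1 := mul_le_mul_of_nonneg_left (iInf_bdry_le g ⟨x.1, hx⟩) (sub_nonneg.2 hK1)
    rw [value_bdry ha h0' hS ⟨x.1, hx⟩, hv.2 x hx]
    linarith
  · obtain ⟨η, hη, hη0, hη1⟩ := hy.symm.exists_curve ha
    have h1 := value_le_integral_add (g := g) ha hf h0' hη (mesh_pos n).le
    have h2 : ∫ t in (0 : ℝ)..mesh n, f (η t) ≤ mesh n * (K * f x.1) := by
      have := intervalIntegral.integral_mono_on (mesh_pos n).le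
        (intervalIntegrable_comp hf hη 0 (mesh n))
        (intervalIntegrable_const (c := K * f x.1)) fun t ht => by
          refine hK _ _ ?_
          rw [← hη0, dist_comm]
          exact (dist_le_sub_of_lipschitzWith hη ht.1).trans (by linarith [ht.2])
      simpa [mul_left_comm] using this
    rw [hη0, hη1] at h1
    have h3 := mul_le_mul_of_nonneg_left hle (show 0 ≤ K by linarith)
    linarith

/-- Perron's method: the pointwise supremum of the discrete subsolutions is a discrete solution. -/
lemma exists_isDiscreteSolution (ha : ∀ i j, i ≠ j → dist (a i) (a j) = 1) (hf : Continuous f)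
    {c : ℝ} (hc : 0 < c) (hcf : ∀ x, c ≤ f x) (hS : CompatGasket a f g) (n : ℕ) :
    ∃ v, IsDiscreteSolution a n f g v := by
  classical
  have h0 : ∀ x, 0 < f x := fun x => hc.trans_le (hcf x)
  obtain ⟨M, hM⟩ := exists_ge f hf
  have hM0 : c ≤ M := (hcf (corner a 0)).trans (hM _)
  have hK : ∀ x y : Gasket a, dist x y ≤ mesh n → f x ≤ M / c * f y := by
    intro x y _
    have h1 : M / c * c ≤ M / c * f y :=
      mul_le_mul_of_nonneg_left (hcf y) (div_nonneg (hc.le.trans hM0) hc.le)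
    rw [div_mul_cancel₀ _ hc.ne'] at h1
    exact (hM x).trans h1
  have hbdd : ∀ x, BddAbove (range fun v : {v // IsDiscreteSubsolution a n f g v} => v.1 x) := by
    intro x
    refine ⟨M / c * value a f g x - (M / c - 1) * ⨅ y, g y, ?_⟩
    rintro - ⟨v, rfl⟩
    exact v.2.le_value ha hf h0 hS ((one_le_div hc).2 hM0) hK x
  have hsub0 : IsDiscreteSubsolution a n f g
      fun x => if hx : x.1 ∈ bdry a then g ⟨x.1, hx⟩ else ⨅ y, g y := by
    refine ⟨fun x hx y _ => ?_, fun x hx => by simp [hx]⟩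
    have h1 := mul_pos (mesh_pos n) (h0 x.1)
    simp only [hx, dite_false]
    split_ifs with hy
    · linarith [iInf_bdry_le g ⟨y.1, hy⟩]
    · linarith
  have hne : Nonempty {v // IsDiscreteSubsolution a n f g v} := ⟨⟨_, hsub0⟩⟩
  set V : vertices a n → ℝ := fun x => ⨆ v : {v // IsDiscreteSubsolution a n f g v}, v.1 x
  have hle : ∀ v : {v // IsDiscreteSubsolution a n f g v}, ∀ x, v.1 x ≤ V x :=
    fun v x => le_ciSup (hbdd x) v
  have hV : IsDiscreteSubsolution a n f g V := by
    refine ⟨fun x hx y hy => ciSup_le fun v => ?_, fun x hx => ?_⟩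
    · linarith [v.2.1 x hx y hy, hle v y]
    · exact le_antisymm (ciSup_le fun v => (v.2.2 x hx).le)
        ((hsub0.2 x hx).symm.le.trans (hle ⟨_, hsub0⟩ x))
  refine ⟨V, (isDiscreteSolution_iff V).2 ⟨hV, fun x hx => ?_⟩⟩
  -- otherwise the value of `V` at `x` could be raised
  by_contra! hlt
  have hex : ∃ b, V x < b ∧ ∀ y : vertices a n, Adj a n (y.1 : Plane) x.1 →
      b ≤ mesh n * f x.1 + V y := by
    have hne : Nonempty {y : vertices a n // Adj a n (y.1 : Plane) x.1} := by
      obtain ⟨y, hy⟩ := exists_adj n x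
      exact ⟨⟨y, hy⟩⟩
    obtain ⟨y, hy⟩ := Finite.exists_min
      fun y : {y : vertices a n // Adj a n (y.1 : Plane) x.1} => mesh n * f x.1 + V y.1
    exact ⟨_, hlt y.1 y.2, fun z hz => hy ⟨z, hz⟩⟩
  obtain ⟨b, hb1, hb2⟩ := hex
  have hup : IsDiscreteSubsolution a n f g (Function.update V x b) := by
    refine ⟨fun z hz y hy => ?_, fun z hz => ?_⟩
    · have hzy : y ≠ z := fun h => hy.ne ha (by rw [h])
      have hge : V y ≤ Function.update V x b y := by
        rcases eq_or_ne y x with rfl | h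
        · simpa using hb1.le
        · simp [h]
      rcases eq_or_ne z x with rfl | h
      · simpa [hzy] using hb2 y hy
      · simp only [Function.update_of_ne h]
        linarith [hV.1 z hz y hy]
    · have : z ≠ x := by
        rintro rfl
        exact hx hz
      rw [Function.update_of_ne this]
      exact hV.2 z hz
  have := hle ⟨_, hup⟩ x
  simp only [Function.update_self] at this
  linarith

/-! ### Convergence -/

lemma abs_sub_le_of_le_of_le {v U m K R : ℝ} (hK : 1 ≤ K) (h1 : v ≤ K * U - (K - 1) * m)
    (h2 : U ≤ K * v - (K - 1) * m) (hm : m ≤ U) (hR : U - m ≤ R) :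
    |v - U| ≤ (K - 1) * K * R := by
  have e1 : (K - 1) * (U - m) ≤ (K - 1) * R := mul_le_mul_of_nonneg_left hR (by linarith)
  have hR0 : 0 ≤ (K - 1) * R := mul_nonneg (by linarith) (by linarith)
  have e2 : (K - 1) * R ≤ K * ((K - 1) * R) := le_mul_of_one_le_left hR0 hK
  have e3 : (K - 1) * (v - m) ≤ (K - 1) * (K * (U - m)) :=
    mul_le_mul_of_nonneg_left (by linarith) (by linarith)
  have e4 : K * ((K - 1) * (U - m)) ≤ K * ((K - 1) * R) :=
    mul_le_mul_of_nonneg_left e1 (by linarith)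
  rw [abs_le]
  constructor <;> linarith

lemma exists_forall_abs_sub_value_lt (ha : ∀ i j, i ≠ j → dist (a i) (a j) = 1)
    (hf : Continuous f) {c : ℝ} (hc : 0 < c) (hcf : ∀ x, c ≤ f x) (hS : CompatGasket a f g) {ε : ℝ}
    (hε : 0 < ε) : ∃ N : ℕ, ∀ n ≥ N, ∀ v : vertices a n → ℝ, IsDiscreteSolution a n f g v →
      ∀ x : vertices a n, |v x - value a f g x| < ε := by
  have h0 : ∀ x, 0 < f x := fun x => hc.trans_le (hcf x)
  have h0' : ∀ x, 0 ≤ f x := fun x => (h0 x).le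
  obtain ⟨M, hM⟩ := exists_ge f hf
  set m := ⨅ y, g y with hm
  set R := M + g ⟨corner a 0, corner_mem_bdry 0⟩ - m with hR
  have hR0 : 0 ≤ R := by
    linarith [iInf_bdry_le g ⟨corner a 0, corner_mem_bdry 0⟩, (h0' (corner a 0)).trans (hM _)]
  set δ := min 1 (ε / (2 * (R + 1))) with hδ
  have hδpos : 0 < δ := by positivity
  have hδR : δ * (1 + δ) * R < ε := by
    have h1 : δ ≤ 1 := min_le_left _ _
    have h2 : δ * (2 * (R + 1)) ≤ ε := (le_div_iff₀ (by positivity)).1 (min_le_right _ _)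
    have h3 : δ * (1 + δ) * R ≤ δ * 2 * R :=
      mul_le_mul_of_nonneg_right (mul_le_mul_of_nonneg_left (by linarith) hδpos.le) hR0
    linarith
  obtain ⟨ρ, hρ, huc⟩ := Metric.uniformContinuous_iff.1
    (CompactSpace.uniformContinuous_of_continuous hf) (δ * c) (mul_pos hδpos hc)
  obtain ⟨N, hN⟩ := exists_pow_lt_of_lt_one hρ (by norm_num : (1 / 2 : ℝ) < 1)
  refine ⟨N, fun n hn v hv x => ?_⟩
  have hmesh : mesh n < ρ := by
    refine lt_of_le_of_lt ?_ hN
    rw [mesh, ← one_div_pow]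
    exact pow_le_pow_of_le_one (by norm_num) (by norm_num) hn
  have hK : ∀ x y, dist x y ≤ mesh n → f x ≤ (1 + δ) * f y := by
    intro x y hxy
    have h1 := (le_abs_self _).trans_lt (huc (hxy.trans_lt hmesh))
    have h2 := mul_le_mul_of_nonneg_left (hcf y) hδpos.le
    linarith
  have hK1 : 1 ≤ 1 + δ := by linarith
  have h1 := ((isDiscreteSolution_iff v).1 hv).1.le_value ha hf h0 hS hK1 hK x
  have h2 := hv.value_le ha hf h0 hS hK1 hK x
  have h3 := value_le_add (g := g) ha hf h0' hM x
  have h4 := abs_sub_le_of_le_of_le hK1 h1 h2 (iInf_le_value ha h0' _) (R := R) (by linarith)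
  refine h4.trans_lt ?_
  rwa [add_sub_cancel_left]

end SierpinskiEikonal

theorem mainTheorem2 (a : Fin 3 → Plane) (ha : ∀ i j, i ≠ j → dist (a i) (a j) = 1)
    (f : Gasket a → ℝ) (hf : Continuous f) (hpos : 0 < ⨅ x, f x)
    (g : bdry a → ℝ) (hS : CompatGasket a f g)
    (hD : ∀ n : ℕ, 1 ≤ n → CompatDiscrete a n f g) :
    (∀ n : ℕ, ∃! v : vertices a n → ℝ, IsDiscreteSolution a n f g v) ∧
    (∃! u : Gasket a → ℝ, IsMetricSolution a f g u) ∧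
    ∀ (v : (n : ℕ) → vertices a n → ℝ) (u : Gasket a → ℝ),
      (∀ n, IsDiscreteSolution a n f g (v n)) → IsMetricSolution a f g u →
      ∀ ε > 0, ∃ N : ℕ, ∀ n ≥ N, ∀ x : vertices a n, |v n x - u x.1| < ε := by
  obtain ⟨c, hc, hcf⟩ := exists_pos_le hf hpos
  have h0 : ∀ x, 0 < f x := fun x => hc.trans_le (hcf x)
  refine ⟨fun n => ?_, ⟨_, isMetricSolution_value ha hf hc hcf hS,
    fun u hu => hu.eq_value ha hf hc hcf hS⟩, fun v u hv hu ε hε => ?_⟩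
  · obtain ⟨v, hv⟩ := exists_isDiscreteSolution ha hf hc hcf hS n
    exact ⟨v, hv, fun w hw => le_antisymm
      (((isDiscreteSolution_iff w).1 hw).1.le_of_isDiscreteSolution h0 hv)
      (((isDiscreteSolution_iff v).1 hv).1.le_of_isDiscreteSolution h0 hw)⟩
  · obtain ⟨N, hN⟩ := exists_forall_abs_sub_value_lt ha hf hc hcf hS hε
    rw [hu.eq_value ha hf hc hcf hS]
    exact ⟨N, fun n hn x => hN n hn (v n) (hv n) x⟩
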